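/- Let $m=(m_0,m_1,\dots)$ be a bounded sequence of integers $m_k\ge 2$, let $G_m=\prod_{k\ge 0}\mathbb Z/m_k\mathbb Z$ be the corresponding (bounded) Vilenkin group with normalized Haar measure $\mu$, and put $M_0=1$, $M_{k+1}=m_kM_k$. For $n=\sum_j n_jM_j$ with $0\le n_j<m_j$ let $\psi_n(x)=\prod_{k}e^{2\pi i x_kn_k/m_k}$ be the Vilenkin functions. Let $\mathcal F_n$ be the $\sigma$-algebra generated by the sets $\{y\in G_m: y_0=x_0,\dots,y_{n-1}=x_{n-1}\}$, $x\in G_m$. For $0<p<\infty$ write $\|g\|_p=(\int|g|^p\,d\mu)^{1/p}$, and let $H_p$ be the space of complex martingales $f=(f^{(n)})_{n\ge 0}$ with respect to $(\mathcal F_n)$ such that $\|f\|_{H_p}:=\|\sup_n|f^{(n)}|\,\|_p<\infty$. For an integrable function $g$, $\|g\|_{H_p}$ denotes the $H_p$-quasi-norm of the martingale $(E[g\mid\mathcal F_n])_n$. For a martingale $f$ put $\widehat f(i)=\lim_{k\to\infty}\int f^{(k)}\overline{\psi_i}\,d\mu$, $S_nf=\sum_{k=0}^{n-1}\widehat f(k)\psi_k$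 and $\sigma_nf=\frac1n\sum_{k=0}^{n-1}S_kf$ for $n\ge 1$ (so $S_0f=0$). a) There is a constant $c$, depending only on $\sup_k m_k$, such that for every $f\in H_{1/2}$ $$\sup_{n\ge 2}\frac{1}{n\log n}\sum_{k=1}^{n}\|\sigma_kf\|_{1/2}^{1/2}\le c\,\|f\|_{H_{1/2}}^{1/2}.$$ b) Let $\varphi:\{1,2,\dots\}\to[1,\infty)$ be nondecreasing with $\limsup_{n\to\infty}\frac{\log n}{\varphi_n}=+\infty$. Then there is $f\in H_{1/2}$ such that $$\sup_{n\ge 1}\frac{1}{n\varphi_n}\sum_{k=1}^{n}\|\sigma_kf\|_{1/2}^{1/2}=\infty\qquad\text{and}\qquad \sup_{n\ge 1}\frac{1}{n\varphi_n}\sum_{k=1}^{n}\|\sigma_kf\|_{H_{1/2}}^{1/2}=\infty .$$ -/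

import Mathlib

open MeasureTheory ProbabilityTheory Filter Topology
open scoped ENNReal NNReal BigOperators

noncomputable section

/-- A generating sequence `m = (m₀, m₁, …)` of integers not less than `2`. -/
structure VilenkinSeq where
  m : ℕ → ℕ
  two_le : ∀ k, 2 ≤ m k

namespace VilenkinSeq

variable (v : VilenkinSeq)

instance instNeZero (k : ℕ) : NeZero (v.m k) := ⟨by have := v.two_le k; omega⟩

/-- The Vilenkin group `G_m`, the complete direct product of the groups `ℤ / m_k ℤ`
(with the product group structure and the product σ-algebra). -/
abbrev Group : Type := (k : ℕ) → ZMod (v.m k)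

instance instIsProbabilityMeasureUniform (k : ℕ) :
    IsProbabilityMeasure (uniformOn (Set.univ : Set (ZMod (v.m k)))) :=
  isProbabilityMeasure_uniformOn Set.finite_univ Set.univ_nonempty

/-- The normalized Haar measure on `G_m`: the product of the measures that give
each `j ∈ ℤ / m_k ℤ` the mass `1 / m_k`. -/
def haar : Measure v.Group :=
  Measure.infinitePi fun k => uniformOn (Set.univ : Set (ZMod (v.m k)))

/-- The generalized powers `M₀ = 1`, `M_{k+1} = m_k M_k`. -/
def M (k : ℕ) : ℕ := ∏ i ∈ Finset.range k, v.m i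

/-- The digits of `n = ∑ⱼ nⱼ Mⱼ`, `0 ≤ nⱼ < mⱼ`. -/
def digit (n j : ℕ) : ℕ := n / v.M j % v.m j

/-- The generalized Rademacher functions `r_k(x) = exp(2πi x_k / m_k)`. -/
def rademacher (k : ℕ) (x : v.Group) : ℂ :=
  Complex.exp (2 * Real.pi * Complex.I * ((x k).val : ℂ) / (v.m k : ℂ))

/-- The Vilenkin functions `ψ_n = ∏_k r_k ^ n_k`. The product may be restricted to `k < n`,
because `n_k = 0` for `k ≥ n` (see `digit_eq_zero_of_le`). -/
def psi (n : ℕ) (x : v.Group) : ℂ :=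
  ∏ k ∈ Finset.range n, v.rademacher k x ^ v.digit n k

theorem lt_M (k : ℕ) : k < v.M k := by
  induction k with
  | zero => simp [M]
  | succ k ih =>
    have h2 := v.two_le k
    have : v.M (k + 1) = v.M k * v.m k := Finset.prod_range_succ _ _
    rw [this]
    nlinarith

theorem digit_eq_zero_of_le {n k : ℕ} (h : n ≤ k) : v.digit n k = 0 := by
  have : n < v.M k := lt_of_le_of_lt h (v.lt_M k)
  simp [digit, Nat.div_eq_of_lt this]

/-- The intervals `I_n(x) = {y : y₀ = x₀, …, y_{n-1} = x_{n-1}}`. -/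
def interval (n : ℕ) (x : v.Group) : Set v.Group := {y | ∀ i < n, y i = x i}

theorem finite_range_interval (n : ℕ) : (Set.range (v.interval n)).Finite := by
  refine (Set.finite_range fun z : (i : Fin n) → ZMod (v.m i) =>
    {y : v.Group | ∀ i : Fin n, y i = z i}).subset ?_
  rintro _ ⟨x, rfl⟩
  refine ⟨fun i => x i, ?_⟩
  ext y
  simp only [interval, Set.mem_ofPred_eq]
  exact ⟨fun h i hi => h ⟨i, hi⟩, fun h i => h i i.2⟩

/-- The filtration `(ℱ_n)` on `G_m`, where `ℱ_n` is generated by the intervals `I_n(x)`. -/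
def filtration : Filtration ℕ (inferInstance : MeasurableSpace v.Group) where
  seq n := MeasurableSpace.generateFrom (Set.range (v.interval n))
  mono' := by
    intro a b hab
    refine MeasurableSpace.generateFrom_le ?_
    rintro _ ⟨x, rfl⟩
    have h : v.interval a x = ⋃₀ {s ∈ Set.range (v.interval b) | s ⊆ v.interval a x} := by
      ext y
      constructor
      · intro hy
        refine ⟨v.interval b y, ⟨⟨y, rfl⟩, ?_⟩, fun i _ => rfl⟩
        intro z hz i hi
        rw [hz i (lt_of_lt_of_le hi hab), hy i hi]
      · rintro ⟨s, ⟨-, hs⟩, hys⟩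
        exact hs hys
    rw [h]
    refine MeasurableSet.sUnion ?_ ?_
    · exact ((v.finite_range_interval b).subset fun s hs => hs.1).countable
    · exact fun s hs => MeasurableSpace.measurableSet_generateFrom hs.1
  le' := by
    intro n
    refine MeasurableSpace.generateFrom_le ?_
    rintro _ ⟨x, rfl⟩
    have h : v.interval n x = ⋂ i ∈ Finset.range n, (fun y : v.Group => y i) ⁻¹' {x i} := by
      ext y
      simp [interval]
    rw [h]
    exact Finset.measurableSet_biInter _ fun i _ => measurable_pi_apply i (MeasurableSet.singleton _)

/-- The Vilenkin–Fourier coefficients `lim_k ∫ f^{(k)} conj(ψ_i) dμ` of a martingale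
`f = (f^{(k)})`; for a martingale the sequence of integrals is eventually constant. -/
def coeff (f : ℕ → v.Group → ℂ) (i : ℕ) : ℂ :=
  limUnder atTop fun k => ∫ x, f k x * (starRingEnd ℂ) (v.psi i x) ∂v.haar

/-- The partial sums `S_n f = ∑_{k=0}^{n-1} f̂(k) ψ_k`. -/
def partialSum (n : ℕ) (f : ℕ → v.Group → ℂ) (x : v.Group) : ℂ :=
  ∑ k ∈ Finset.range n, v.coeff f k * v.psi k x

/-- The Fejér means `σ_n f = (1/n) ∑_{k=0}^{n-1} S_k f`. -/
def fejer (n : ℕ) (f : ℕ → v.Group → ℂ) (x : v.Group) : ℂ :=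
  (n : ℂ)⁻¹ * ∑ k ∈ Finset.range n, v.partialSum k f x

/-- The maximal function `f^* = sup_n |f^{(n)}|`. -/
def maximal (f : ℕ → v.Group → ℂ) (x : v.Group) : ℝ≥0∞ := ⨆ n, ‖f n x‖ₑ

/-- The quantity `‖f‖_{H_p} = ‖f^*‖_p`. -/
def hardyNorm (f : ℕ → v.Group → ℂ) (p : ℝ≥0∞) : ℝ≥0∞ := eLpNorm (v.maximal f) p v.haar

/-- The martingale Hardy space `H_p`. -/
def MemHardy (f : ℕ → v.Group → ℂ) (p : ℝ≥0∞) : Prop :=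
  Martingale f v.filtration v.haar ∧ v.hardyNorm f p < ∞

/-- The regular martingale `(E_n g)` generated by an integrable function `g`. -/
def regularMartingale (g : v.Group → ℂ) (n : ℕ) : v.Group → ℂ :=
  v.haar[g | v.filtration n]

end VilenkinSeq

end

/-! Part a) rests on the bound ∫√|σ_n f| ≤ C log n · ∫√f* for each n ≥ 2 (`integral_sqrt_fejer_le`);
averaging over k ≤ n then costs nothing.

The unit of the argument is an atom: a function bounded by T, supported on an interval of level N
and orthogonal to all functions of the first N coordinates. On the interval, an L² bound for σ_n
suffices. Off it, let k < l be the first two coordinates where x leaves the interval. The sum of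
Dirichlet kernels is at most 2 M_{k+1} M_{l+1} there (`norm_fejerSum_le`), and the set of such x has
measure at most m_k / M_l. After square roots the sum over l converges geometrically and each k < N
contributes equally, so ∫√|σ_n a| ≤ C (N+1) √T / M_N (`integral_sqrt_fejer_atom_le`). Since σ_n a =
0 for n ≤ M_N, only N of order at most log n matters.

A general f is stopped just before it may exceed the thresholds 4^k ε. Differences of consecutive
stopped functions split into atoms over the sets where stopping occurs. As the m_k are bounded,
stopping one step early enlarges these sets by a factor of at most B compared with {f* > 4^k ε}. A
geometric sum over k recovers ∫√f*.

For part b) the loss of log n is genuine: the sum over j < M_N of ∫√|Σ_{i<j} D_i| is at least of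
order N M_N (`le_sum_integral_sqrt_fejerSum`), every layer I_k \ I_{k+1} with 2 ≤ k < N giving the
same amount. The martingale f has coefficients 4^{-i} M_{N_i} on the block [M_{N_i}, M_{N_i+1}) and
0 elsewhere. It lies in H_{1/2} because Σ 2^{-i} converges, while for M_{N_i} ≤ n < 2M_{N_i} the
mean σ_n f contains the kernel of that block plus an error governed by earlier blocks. A sparse
choice of N_i makes the averages beat any φ allowed in the statement. -/

namespace VilenkinSeq

variable (v : VilenkinSeq)

/-! ### Digits and multiplicativity of the Vilenkin functions. -/

@[simp] theorem M_zero : v.M 0 = 1 := rfl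

theorem M_succ (k : ℕ) : v.M (k + 1) = v.m k * v.M k := by
  rw [M, M, Finset.prod_range_succ, mul_comm]

theorem M_pos (k : ℕ) : 0 < v.M k := by
  have := v.lt_M k; omega

theorem M_dvd {j k : ℕ} (h : j ≤ k) : v.M j ∣ v.M k :=
  Finset.prod_dvd_prod_of_subset _ _ _ (Finset.range_subset_range.2 h)

theorem M_mono : Monotone v.M := fun _ k h => Nat.le_of_dvd (v.M_pos k) (v.M_dvd h)

theorem two_mul_M_le (k : ℕ) : 2 * v.M k ≤ v.M (k + 1) := by
  rw [M_succ]; exact Nat.mul_le_mul_right _ (v.two_le k)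

theorem two_pow_mul_M_le (k j : ℕ) : 2 ^ j * v.M k ≤ v.M (k + j) := by
  induction j with
  | zero => simp
  | succ j ih =>
    have := v.two_mul_M_le (k + j)
    rw [pow_succ, ← add_assoc]; nlinarith

theorem two_pow_le_M (k : ℕ) : 2 ^ k ≤ v.M k := by
  simpa using v.two_pow_mul_M_le 0 k

theorem rademacher_eq (k : ℕ) (x : v.Group) : v.rademacher k x = ZMod.stdAddChar (x k) := by
  rw [ZMod.stdAddChar_apply, ZMod.toCircle_apply, rademacher]

theorem rademacher_add (k : ℕ) (x y : v.Group) :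
    v.rademacher k (x + y) = v.rademacher k x * v.rademacher k y := by
  simp only [rademacher_eq, Pi.add_apply, AddChar.map_add_eq_mul]

theorem norm_rademacher (k : ℕ) (x : v.Group) : ‖v.rademacher k x‖ = 1 := by
  rw [rademacher_eq, ZMod.stdAddChar_apply]; exact Circle.norm_coe _

theorem rademacher_of_eq_zero {k : ℕ} {x : v.Group} (h : x k = 0) : v.rademacher k x = 1 := by
  rw [rademacher_eq, h, AddChar.map_zero_eq_one]

theorem rademacher_ne_one {k : ℕ} {x : v.Group} (h : x k ≠ 0) : v.rademacher k x ≠ 1 := by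
  rw [rademacher_eq, ← AddChar.map_zero_eq_one (ZMod.stdAddChar (N := v.m k))]
  exact fun h' => h (ZMod.injective_stdAddChar h')

theorem rademacher_pow_m (k : ℕ) (x : v.Group) : v.rademacher k x ^ v.m k = 1 := by
  rw [rademacher_eq, ← AddChar.map_nsmul_eq_pow]
  simp [AddChar.map_zero_eq_one]

theorem geom_rademacher {k : ℕ} {x : v.Group} (h : x k ≠ 0) :
    ∑ u ∈ Finset.range (v.m k), v.rademacher k x ^ u = 0 := by
  have := geom_sum_mul (v.rademacher k x) (v.m k)
  rw [rademacher_pow_m, sub_self] at this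
  exact (mul_eq_zero.1 this).resolve_right (sub_ne_zero.2 (v.rademacher_ne_one h))

theorem digit_eq_zero_of_lt_M {n k j : ℕ} (h : n < v.M k) (hj : k ≤ j) : v.digit n j = 0 := by
  simp [digit, Nat.div_eq_of_lt (h.trans_le (v.M_mono hj))]

theorem psi_eq_prod {n K : ℕ} (h : n < v.M K) (x : v.Group) :
    v.psi n x = ∏ k ∈ Finset.range K, v.rademacher k x ^ v.digit n k := by
  rw [psi]
  rcases le_total n K with h' | h'
  · refine Finset.prod_subset (Finset.range_subset_range.2 h') fun k _ hk => ?_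
    rw [v.digit_eq_zero_of_le (by simpa using hk), pow_zero]
  · refine (Finset.prod_subset (Finset.range_subset_range.2 h') fun k _ hk => ?_).symm
    rw [v.digit_eq_zero_of_lt_M h (by simpa using hk), pow_zero]

theorem psi_add (n : ℕ) (x y : v.Group) : v.psi n (x + y) = v.psi n x * v.psi n y := by
  simp only [psi, rademacher_add, mul_pow, Finset.prod_mul_distrib]

theorem norm_psi (n : ℕ) (x : v.Group) : ‖v.psi n x‖ = 1 := by
  simp [psi, norm_rademacher]

theorem psi_zero_right (n : ℕ) : v.psi n 0 = 1 := by
  refine Finset.prod_eq_one fun k _ => ?_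
  rw [v.rademacher_of_eq_zero rfl, one_pow]

theorem psi_sub (n : ℕ) (x y : v.Group) :
    v.psi n (x - y) = v.psi n x * (starRingEnd ℂ) (v.psi n y) := by
  have h := v.psi_add n (x - y) y
  have h2 : v.psi n y * (starRingEnd ℂ) (v.psi n y) = 1 := by
    rw [Complex.mul_conj, Complex.normSq_eq_norm_sq, norm_psi]; simp
  rw [sub_add_cancel] at h
  rw [h, mul_assoc, h2, mul_one]

theorem psi_zero (x : v.Group) : v.psi 0 x = 1 := by simp [psi]

theorem psi_congr {n K : ℕ} (h : n < v.M K) {x y : v.Group} (hxy : ∀ i < K, x i = y i) :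
    v.psi n x = v.psi n y := by
  rw [v.psi_eq_prod h, v.psi_eq_prod h]
  refine Finset.prod_congr rfl fun k hk => ?_
  rw [rademacher_eq, rademacher_eq, hxy k (Finset.mem_range.1 hk)]

theorem digit_mul_M_of_lt (b : ℕ) {j k : ℕ} (h : j < k) : v.digit (b * v.M k) j = 0 := by
  obtain ⟨c, hc⟩ := v.M_dvd (Nat.succ_le_of_lt h)
  have : b * v.M k = v.M j * (v.m j * (b * c)) := by rw [hc, Nat.succ_eq_add_one, M_succ]; ring
  rw [digit, this, Nat.mul_div_cancel_left _ (v.M_pos j), Nat.mul_mod_right]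

/-- There is no carry: multiples of M_k use only digits from k on, and s < M_k only digits below k.
This makes ψ multiplicative across blocks in `psi_block`. -/
theorem digit_block (b : ℕ) {s k : ℕ} (hs : s < v.M k) (j : ℕ) :
    v.digit (b * v.M k + s) j = v.digit (b * v.M k) j + v.digit s j := by
  rcases lt_or_ge j k with h | h
  · rw [v.digit_mul_M_of_lt b h, zero_add]
    obtain ⟨c, hc⟩ := v.M_dvd (Nat.succ_le_of_lt h)
    have : b * v.M k + s = s + v.M j * (v.m j * (b * c)) := by
      rw [hc, Nat.succ_eq_add_one, M_succ]; ring
    rw [digit, digit, this, Nat.add_mul_div_left _ _ (v.M_pos j), Nat.add_mul_mod_self_left]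
  · rw [v.digit_eq_zero_of_lt_M hs h, add_zero]
    obtain ⟨c, hc⟩ := v.M_dvd h
    rw [digit, digit, hc, ← Nat.div_div_eq_div_mul, ← Nat.div_div_eq_div_mul]
    congr 2
    rw [Nat.mul_div_cancel _ (v.M_pos k), mul_comm, Nat.mul_add_div (v.M_pos k),
      Nat.div_eq_of_lt hs, add_zero]

theorem psi_block (b : ℕ) {s k : ℕ} (hs : s < v.M k) (x : v.Group) :
    v.psi (b * v.M k + s) x = v.psi (b * v.M k) x * v.psi s x := by
  have h := v.lt_M (b * v.M k + s)
  rw [v.psi_eq_prod h, v.psi_eq_prod (K := b * v.M k + s) (lt_of_le_of_lt (by omega) h),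
    v.psi_eq_prod (n := s) (K := b * v.M k + s) (lt_of_le_of_lt (by omega) h),
    ← Finset.prod_mul_distrib]
  refine Finset.prod_congr rfl fun j _ => ?_
  rw [v.digit_block b hs, pow_add]

theorem psi_mul_M {b k : ℕ} (hb : b < v.m k) (x : v.Group) :
    v.psi (b * v.M k) x = v.rademacher k x ^ b := by
  have h : b * v.M k < v.M (k + 1) := by
    rw [M_succ]; exact Nat.mul_lt_mul_of_pos_right hb (v.M_pos k)
  rw [v.psi_eq_prod h, Finset.prod_range_succ, Finset.prod_eq_one, one_mul]
  · rw [digit, Nat.mul_div_cancel _ (v.M_pos k), Nat.mod_eq_of_lt hb]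
  · intro j hj
    rw [v.digit_mul_M_of_lt b (Finset.mem_range.1 hj), pow_zero]

theorem psi_mul_M_congr (b : ℕ) {k : ℕ} {x y : v.Group} (hxy : ∀ i, k ≤ i → x i = y i) :
    v.psi (b * v.M k) x = v.psi (b * v.M k) y := by
  refine Finset.prod_congr rfl fun j _ => ?_
  rcases lt_or_ge j k with h | h
  · rw [v.digit_mul_M_of_lt b h, pow_zero, pow_zero]
  · rw [rademacher_eq, rademacher_eq, hxy j h]

/-! ### Dirichlet kernels and their sums: block formulas and upper bounds. -/

/-- The Dirichlet kernel `D_n = ∑_{k < n} ψ_k`. -/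
noncomputable def dirichlet (n : ℕ) (x : v.Group) : ℂ := ∑ k ∈ Finset.range n, v.psi k x

/-- The unnormalized Fejér kernel `∑_{i < n} D_i`. -/
noncomputable def fejerSum (n : ℕ) (x : v.Group) : ℂ := ∑ i ∈ Finset.range n, v.dirichlet i x

theorem norm_dirichlet_le (n : ℕ) (x : v.Group) : ‖v.dirichlet n x‖ ≤ n := by
  refine (norm_sum_le _ _).trans ?_
  simp [norm_psi]

theorem dirichlet_block (a : ℕ) {s k : ℕ} (hs : s ≤ v.M k) (x : v.Group) :
    v.dirichlet (a * v.M k + s) x =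
      v.dirichlet (a * v.M k) x + v.psi (a * v.M k) x * v.dirichlet s x := by
  rw [dirichlet, Finset.sum_range_add, dirichlet, dirichlet, Finset.mul_sum]
  congr 1
  exact Finset.sum_congr rfl fun j hj => v.psi_block a (by have := Finset.mem_range.1 hj; omega) x

theorem dirichlet_mul_M (a k : ℕ) (x : v.Group) :
    v.dirichlet (a * v.M k) x =
      v.dirichlet (v.M k) x * ∑ b ∈ Finset.range a, v.psi (b * v.M k) x := by
  induction a with
  | zero => simp [dirichlet]
  | succ a ih =>
    rw [add_mul, one_mul, v.dirichlet_block a le_rfl, ih, Finset.sum_range_succ]; ring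

theorem dirichlet_of_le {n k : ℕ} (hn : n ≤ v.M k) {x : v.Group} (hx : ∀ i < k, x i = 0) :
    v.dirichlet n x = n := by
  rw [dirichlet, Finset.sum_congr rfl (g := fun _ => (1 : ℂ)), Finset.sum_const,
    Finset.card_range, nsmul_one]
  intro j hj
  rw [v.psi_congr (y := 0) ((Finset.mem_range.1 hj).trans_le hn) hx, psi_zero_right]

/-- D_{M_{k+1}} is D_{M_k} times the full geometric sum of the powers of r_k, which vanishes where
x_k ≠ 0. -/
theorem dirichlet_M_eq_zero {k : ℕ} {x : v.Group} (hx : ∃ i < k, x i ≠ 0) :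
    v.dirichlet (v.M k) x = 0 := by
  induction k with
  | zero => obtain ⟨i, hi, _⟩ := hx; omega
  | succ k ih =>
    rw [M_succ, dirichlet_mul_M]
    by_cases h : ∃ i < k, x i ≠ 0
    · rw [ih h, zero_mul]
    · obtain ⟨i, hi, hxi⟩ := hx
      have : i = k := by
        by_contra hne
        exact h ⟨i, by omega, hxi⟩
      subst this
      rw [Finset.sum_congr rfl fun b hb => v.psi_mul_M (Finset.mem_range.1 hb) x,
        v.geom_rademacher hxi, mul_zero]

theorem dirichlet_mul_M_eq_zero (a : ℕ) {k : ℕ} {x : v.Group} (hx : ∃ i < k, x i ≠ 0) :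
    v.dirichlet (a * v.M k) x = 0 := by
  rw [dirichlet_mul_M, v.dirichlet_M_eq_zero hx, zero_mul]

/-- Complete blocks of length M_k contribute nothing at x; only the remainder of n modulo M_k is
left. -/
theorem norm_dirichlet_le_M (n : ℕ) {k : ℕ} {x : v.Group} (hx : ∃ i < k, x i ≠ 0) :
    ‖v.dirichlet n x‖ ≤ v.M k := by
  have hr := (Nat.mod_lt n (v.M_pos k)).le
  rw [← Nat.div_add_mod' n (v.M k), v.dirichlet_block _ hr, v.dirichlet_mul_M_eq_zero _ hx,
    zero_add, norm_mul, norm_psi, one_mul]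
  exact (v.norm_dirichlet_le _ _).trans (by exact_mod_cast hr)

/-- Since D_{a M_k} vanishes at x, the additive term of `dirichlet_block` disappears and a shift by
a M_k only multiplies by a number of modulus one. -/
theorem fejerSum_block (a : ℕ) {s k : ℕ} (hs : s ≤ v.M k) {x : v.Group}
    (hx : ∃ i < k, x i ≠ 0) :
    v.fejerSum (a * v.M k + s) x =
      v.fejerSum (a * v.M k) x + v.psi (a * v.M k) x * v.fejerSum s x := by
  rw [fejerSum, Finset.sum_range_add, fejerSum, fejerSum, Finset.mul_sum]
  congr 1
  refine Finset.sum_congr rfl fun j hj => ?_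
  rw [v.dirichlet_block a (by have := Finset.mem_range.1 hj; omega) x,
    v.dirichlet_mul_M_eq_zero a hx, zero_add]

theorem fejerSum_mul_M (a : ℕ) {k : ℕ} {x : v.Group} (hx : ∃ i < k, x i ≠ 0) :
    v.fejerSum (a * v.M k) x =
      v.fejerSum (v.M k) x * ∑ b ∈ Finset.range a, v.psi (b * v.M k) x := by
  induction a with
  | zero => simp [fejerSum]
  | succ a ih =>
    rw [add_mul, one_mul, v.fejerSum_block a le_rfl hx, ih, Finset.sum_range_succ]; ring

/-- Sums of `ψ_{b M_k}` see only the coordinates from `k` on. -/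
theorem M_mul_norm_sum_psi_mul_M_le (a : ℕ) {k l : ℕ} (hkl : k ≤ l) {x : v.Group}
    (hx : x l ≠ 0) :
    v.M k * ‖∑ b ∈ Finset.range a, v.psi (b * v.M k) x‖ ≤ v.M (l + 1) := by
  classical
  -- Zeroing the coordinates below k leaves every ψ_{b M_k} unchanged and makes D_{M_k} equal to
  -- M_k, so the sum can be read off from a Dirichlet kernel at z.
  let z : v.Group := fun i => if i < k then 0 else x i
  have hz : ∀ i < k, z i = 0 := fun i hi => if_pos hi
  have hzl : z l = x l := if_neg (by omega)
  have h1 : v.dirichlet (a * v.M k) z = v.M k * ∑ b ∈ Finset.range a, v.psi (b * v.M k) x := by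
    rw [dirichlet_mul_M, v.dirichlet_of_le le_rfl hz]
    congr 1
    exact Finset.sum_congr rfl fun b _ => v.psi_mul_M_congr b fun i hi => if_neg (by omega)
  have h2 := v.norm_dirichlet_le_M (a * v.M k) (k := l + 1) (x := z)
    ⟨l, by omega, by rwa [hzl]⟩
  rwa [h1, norm_mul, Complex.norm_natCast] at h2

theorem norm_fejerSum_le_mul {n K : ℕ} (hn : n ≤ K) {x : v.Group} {c : ℝ}
    (hc : ∀ i < n, ‖v.dirichlet i x‖ ≤ c) (h0 : 0 ≤ c) : ‖v.fejerSum n x‖ ≤ K * c := by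
  refine (norm_sum_le_of_le _ fun i hi => hc i (Finset.mem_range.1 hi)).trans ?_
  rw [Finset.sum_const, Finset.card_range, nsmul_eq_mul]
  gcongr

theorem norm_fejerSum_le_mul_M (n : ℕ) {k : ℕ} {x : v.Group} (hx : ∃ i < k, x i ≠ 0) :
    ‖v.fejerSum n x‖ ≤ n * v.M k :=
  v.norm_fejerSum_le_mul le_rfl (fun i _ => v.norm_dirichlet_le_M i hx) (by positivity)

/-- Cut n at multiples of M_{k+1}. The complete blocks give at most M_{k+1}² times a character sum
of size at most M_{l+1} / M_{k+1}, and the incomplete block at most M_{k+1}². The bound is uniform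
in n, which makes the factor 1/n in σ_n useful. -/
theorem norm_fejerSum_le (n : ℕ) {k l : ℕ} (hkl : k < l) {x : v.Group}
    (hk : x k ≠ 0) (hl : x l ≠ 0) :
    ‖v.fejerSum n x‖ ≤ 2 * (v.M (k + 1) * v.M (l + 1)) := by
  have hx : ∃ i < k + 1, x i ≠ 0 := ⟨k, by omega, hk⟩
  have hr := (Nat.mod_lt n (v.M_pos (k + 1))).le
  have h1 := v.M_mul_norm_sum_psi_mul_M_le (n / v.M (k + 1)) (k := k + 1) (l := l) hkl hl
  have h2 := v.norm_fejerSum_le_mul_M (v.M (k + 1)) hx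
  have h3 := v.norm_fejerSum_le_mul_M (n % v.M (k + 1)) hx
  have h4 : ((n % v.M (k + 1) : ℕ) : ℝ) ≤ v.M (k + 1) := by exact_mod_cast hr
  have h5 : (v.M (k + 1) : ℝ) ≤ v.M (l + 1) := by exact_mod_cast v.M_mono (by omega)
  have h0 : (0 : ℝ) ≤ v.M (k + 1) := by positivity
  rw [← Nat.div_add_mod' n (v.M (k + 1)), v.fejerSum_block _ hr hx, v.fejerSum_mul_M _ hx]
  refine (norm_add_le _ _).trans ?_
  rw [norm_mul, norm_mul, norm_psi, one_mul]
  set S := ‖∑ b ∈ Finset.range (n / v.M (k + 1)), v.psi (b * v.M (k + 1)) x‖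
  have hS : 0 ≤ S := norm_nonneg _
  have h6 : ‖v.fejerSum (v.M (k + 1)) x‖ * S ≤ v.M (k + 1) * v.M (l + 1) := by
    calc _ ≤ (v.M (k + 1) * v.M (k + 1)) * S := by gcongr
      _ = v.M (k + 1) * (v.M (k + 1) * S) := by ring
      _ ≤ _ := by gcongr
  have h7 : ((n % v.M (k + 1) : ℕ) : ℝ) * v.M (k + 1) ≤ v.M (k + 1) * v.M (l + 1) := by
    gcongr
  linarith

theorem fejerSum_of_le {n k : ℕ} (hn : n ≤ v.M k) {x : v.Group} (hx : ∀ i < k, x i = 0) :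
    v.fejerSum n x = ((n * (n - 1) / 2 : ℝ) : ℂ) := by
  induction n with
  | zero => simp [fejerSum]
  | succ n ih =>
    rw [fejerSum, Finset.sum_range_succ, ← fejerSum, ih (by omega),
      v.dirichlet_of_le (by omega) hx]
    push_cast; ring

end VilenkinSeq

/-! ### Haar measure, functions of finitely many coordinates, orthogonality, martingales. -/

namespace VilenkinSeq

variable (v : VilenkinSeq)

instance instIsProbabilityMeasureHaar : IsProbabilityMeasure v.haar := by
  unfold haar; infer_instance

theorem uniformOn_map_add (k : ℕ) (c : ZMod (v.m k)) :
    (uniformOn (Set.univ : Set (ZMod (v.m k)))).map (· + c) = uniformOn Set.univ := by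
  ext s hs
  have h : (· + c) ⁻¹' s = (Equiv.addRight c).symm '' s := by
    rw [Equiv.image_symm_eq_preimage]; rfl
  rw [Measure.map_apply (measurable_of_finite _) hs, uniformOn_univ, uniformOn_univ, h,
    Measure.count_injective_image (Equiv.injective _)]

theorem measurePreserving_add (t : v.Group) :
    MeasurePreserving (fun x : v.Group => x + t) v.haar v.haar := by
  refine ⟨measurable_pi_lambda _ fun k => (measurable_of_finite (· + t k)).comp
    (measurable_pi_apply k), ?_⟩
  have h := Measure.infinitePi_map_pi
    (μ := fun k => uniformOn (Set.univ : Set (ZMod (v.m k))))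
    (f := fun k x => x + t k) (fun k => measurable_of_finite _)
  simp only [uniformOn_map_add] at h
  exact h

theorem haar_cylinder (s : Finset ℕ) (x : v.Group) :
    v.haar {y | ∀ i ∈ s, y i = x i} = ∏ i ∈ s, (v.m i : ℝ≥0∞)⁻¹ := by
  have h : {y : v.Group | ∀ i ∈ s, y i = x i} = Set.pi s fun i => {x i} := by
    ext y; simp [Set.mem_pi]
  rw [h, haar, Measure.infinitePi_pi _ fun i _ => measurableSet_singleton _]
  refine Finset.prod_congr rfl fun i _ => ?_
  rw [uniformOn_univ, Measure.count_singleton, ZMod.card, one_div]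

theorem haar_real_cylinder (s : Finset ℕ) (x : v.Group) :
    v.haar.real {y | ∀ i ∈ s, y i = x i} = ∏ i ∈ s, (v.m i : ℝ)⁻¹ := by
  rw [measureReal_def, haar_cylinder, ENNReal.toReal_prod]
  simp

theorem interval_eq (n : ℕ) (x : v.Group) :
    v.interval n x = {y | ∀ i ∈ Finset.range n, y i = x i} := by
  ext y; simp [interval]

theorem haar_real_interval (n : ℕ) (x : v.Group) :
    v.haar.real (v.interval n x) = (v.M n : ℝ)⁻¹ := by
  rw [interval_eq, haar_real_cylinder, M, Nat.cast_prod, Finset.prod_inv_distrib]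

variable {v}

/-- Functions of the first `n` coordinates. -/
def LevelFun {α : Type*} (n : ℕ) (g : v.Group → α) : Prop :=
  ∀ ⦃x y : v.Group⦄, (∀ i < n, x i = y i) → g x = g y

theorem LevelFun.mono {α : Type*} {n k : ℕ} {g : v.Group → α} (h : LevelFun n g) (hk : n ≤ k) :
    LevelFun k g := fun _ _ hxy => h fun i hi => hxy i (hi.trans_le hk)

theorem LevelFun.comp {α β : Type*} {n : ℕ} {g : v.Group → α} (h : LevelFun n g) (φ : α → β) :
    LevelFun n fun x => φ (g x) := fun _ _ hxy => congrArg φ (h hxy)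

theorem LevelFun.comp₂ {α β γ : Type*} {n : ℕ} {g : v.Group → α} {g' : v.Group → β}
    (h : LevelFun n g) (h' : LevelFun n g') (φ : α → β → γ) :
    LevelFun n fun x => φ (g x) (g' x) := fun _ _ hxy => congrArg₂ φ (h hxy) (h' hxy)

theorem levelFun_const {α : Type*} (n : ℕ) (c : α) : LevelFun n fun _ : v.Group => c :=
  fun _ _ _ => rfl

theorem LevelFun.sum {ι E : Type*} [AddCommMonoid E] {n : ℕ} {s : Finset ι}
    {g : ι → v.Group → E} (h : ∀ i ∈ s, LevelFun n (g i)) :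
    LevelFun n fun x => ∑ i ∈ s, g i x :=
  fun _ _ hxy => Finset.sum_congr rfl fun i hi => h i hi hxy

theorem levelFun_psi {n K : ℕ} (h : n < v.M K) : LevelFun K (v.psi n) :=
  fun _ _ hxy => v.psi_congr h hxy

theorem LevelFun.finite_range {α : Type*} {n : ℕ} {g : v.Group → α} (h : LevelFun n g) :
    (Set.range g).Finite := by
  classical
  refine (Set.finite_range fun z : (i : Fin n) → ZMod (v.m i) =>
    g fun i => if hi : i < n then z ⟨i, hi⟩ else 0).subset ?_
  rintro _ ⟨x, rfl⟩
  exact ⟨fun i => x i, h fun i hi => dif_pos hi⟩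

theorem LevelFun.measurableSet {n : ℕ} {P : v.Group → Prop} (h : LevelFun n P) :
    MeasurableSet[v.filtration n] {x | P x} := by
  have hs : {x | P x} = ⋃₀ {s ∈ Set.range (v.interval n) | s ⊆ {x | P x}} := by
    ext x
    constructor
    · intro hx
      exact ⟨v.interval n x, ⟨⟨x, rfl⟩, fun y hy => (h hy).mpr hx⟩, fun i _ => rfl⟩
    · rintro ⟨s, ⟨-, hs⟩, hxs⟩
      exact hs hxs
  rw [hs]
  exact MeasurableSet.sUnion ((v.finite_range_interval n).subset fun s hs => hs.1).countable
    fun s hs => MeasurableSpace.measurableSet_generateFrom hs.1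

theorem LevelFun.measurableSet' {n : ℕ} {P : v.Group → Prop} (h : LevelFun n P) :
    MeasurableSet {x | P x} := v.filtration.le n _ h.measurableSet

theorem LevelFun.measurable {α : Type*} [MeasurableSpace α] {n : ℕ} {g : v.Group → α}
    (h : LevelFun n g) : Measurable[v.filtration n] g :=
  fun s _ => (h.comp (· ∈ s)).measurableSet

theorem LevelFun.stronglyMeasurable {E : Type*} [NormedAddCommGroup E]
    [SecondCountableTopology E] {n : ℕ} {g : v.Group → E} (h : LevelFun n g) :
    StronglyMeasurable[v.filtration n] g := by
  borelize E
  exact Measurable.stronglyMeasurable h.measurable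

theorem LevelFun.integrable {E : Type*} [NormedAddCommGroup E]
    [SecondCountableTopology E] {n : ℕ} {g : v.Group → E} (h : LevelFun n g) :
    Integrable g v.haar := by
  obtain ⟨C, hC⟩ := (h.comp norm).finite_range.bddAbove
  exact Integrable.of_bound (h.stronglyMeasurable.mono (v.filtration.le n)).aestronglyMeasurable C
    (ae_of_all _ fun x => hC ⟨x, rfl⟩)

theorem levelFun_mem_of_measurableSet {n : ℕ} {s : Set v.Group}
    (h : MeasurableSet[v.filtration n] s) : LevelFun n (· ∈ s) := by
  induction s, h using MeasurableSpace.generateFrom_induction with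
  | hC t ht =>
    obtain ⟨z, rfl⟩ := ht
    intro x y hxy
    refine propext ⟨fun h i hi => ?_, fun h i hi => ?_⟩
    · rw [← hxy i hi, h i hi]
    · rw [hxy i hi, h i hi]
  | empty => exact fun _ _ _ => rfl
  | compl t _ ih => exact fun x y hxy => congrArg Not (ih hxy)
  | iUnion t _ ih =>
    intro x y hxy
    simp only [Set.mem_iUnion]
    exact propext (exists_congr fun i => (ih i hxy).to_iff)

/-- The atoms of ℱ_n are the intervals of level n, so measurability forces constancy on them
everywhere, not just almost everywhere. Martingale terms can therefore be treated pointwise. -/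
theorem levelFun_of_stronglyMeasurable {E : Type*} [NormedAddCommGroup E] {n : ℕ}
    {g : v.Group → E} (h : StronglyMeasurable[v.filtration n] g) : LevelFun n g := by
  borelize E
  intro x y hxy
  have hm := h.measurable (measurableSet_singleton (g x))
  exact (((levelFun_mem_of_measurableSet hm) hxy).mp rfl).symm

theorem LevelFun.integral_add_right {E : Type*} [NormedAddCommGroup E] [NormedSpace ℝ E]
    [SecondCountableTopology E] {n : ℕ} {g : v.Group → E} (h : LevelFun n g) (t : v.Group) :
    ∫ x, g (x + t) ∂v.haar = ∫ x, g x ∂v.haar := by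
  have hp := v.measurePreserving_add t
  conv_rhs => rw [← hp.map_eq]
  rw [integral_map hp.measurable.aemeasurable]
  exact (h.stronglyMeasurable.mono (v.filtration.le n)).aestronglyMeasurable

/-- A function multiplied by a constant `ω ≠ 1` under a translation has integral `0`. -/
theorem LevelFun.integral_eq_zero {n : ℕ} {g : v.Group → ℂ} (h : LevelFun n g) (t : v.Group)
    {ω : ℂ} (hω : ω ≠ 1) (ht : ∀ x, g (x + t) = ω * g x) : ∫ x, g x ∂v.haar = 0 := by
  have h1 := h.integral_add_right t
  simp only [ht] at h1
  rw [integral_const_mul] at h1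
  have h2 : (ω - 1) * ∫ x, g x ∂v.haar = 0 := by rw [sub_mul, h1, one_mul, sub_self]
  exact (mul_eq_zero.1 h2).resolve_left (sub_ne_zero.2 hω)

variable (v) in
theorem digit_lt (n j : ℕ) : v.digit n j < v.m j :=
  Nat.mod_lt _ (by have := v.two_le j; omega)

variable (v) in
theorem mod_M_succ (n k : ℕ) : n % v.M (k + 1) = n % v.M k + v.M k * v.digit n k := by
  rw [M_succ, mul_comm, Nat.mod_mul, digit]

variable (v) in
theorem eq_of_digit_eq {i k : ℕ} (h : ∀ j, v.digit i j = v.digit k j) : i = k := by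
  have h1 : ∀ K, i % v.M K = k % v.M K := by
    intro K
    induction K with
    | zero => simp [Nat.mod_one]
    | succ K ih => rw [mod_M_succ, mod_M_succ, ih, h]
  have h2 := h1 (i + k)
  have h3 := v.lt_M (i + k)
  rwa [Nat.mod_eq_of_lt (by omega), Nat.mod_eq_of_lt (by omega)] at h2

-- Evaluation at a unit vector reads off one digit. Translation by that vector is what proves
-- orthogonality below.
variable (v) in
theorem psi_single (n j : ℕ) :
    v.psi n (Pi.single j 1) = ZMod.stdAddChar ((v.digit n j : ℕ) : ZMod (v.m j)) := by
  have h : n < v.M (n + j + 1) := lt_of_le_of_lt (by omega) (v.lt_M _)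
  rw [v.psi_eq_prod h, Finset.prod_eq_single j]
  · rw [rademacher_eq, Pi.single_eq_same, ← AddChar.map_nsmul_eq_pow, nsmul_one]
  · intro i _ hi
    rw [v.rademacher_of_eq_zero (Pi.single_eq_of_ne hi _), one_pow]
  · simp

variable (v) in
theorem psi_single_injective {i k j : ℕ}
    (h : v.psi i (Pi.single j 1) = v.psi k (Pi.single j 1)) : v.digit i j = v.digit k j := by
  rw [psi_single, psi_single] at h
  have h1 := congrArg ZMod.val (ZMod.injective_stdAddChar h)
  rwa [ZMod.val_natCast_of_lt (v.digit_lt _ _), ZMod.val_natCast_of_lt (v.digit_lt _ _)] at h1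

variable (v) in
theorem psi_mul_conj (n : ℕ) (x : v.Group) : v.psi n x * (starRingEnd ℂ) (v.psi n x) = 1 := by
  rw [← psi_sub, sub_self, psi_zero_right]

variable (v) in
theorem integral_psi_mul_conj (i k : ℕ) :
    ∫ x, v.psi i x * (starRingEnd ℂ) (v.psi k x) ∂v.haar = if i = k then 1 else 0 := by
  split_ifs with h
  · subst h
    simp [psi_mul_conj]
  · obtain ⟨j, hj⟩ : ∃ j, v.digit i j ≠ v.digit k j := by
      by_contra! h'
      exact h (v.eq_of_digit_eq h')
    have hi := v.lt_M (i + k)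
    have hl : LevelFun (i + k) fun x => v.psi i x * (starRingEnd ℂ) (v.psi k x) :=
      (levelFun_psi (by omega)).comp₂ (levelFun_psi (K := i + k) (by omega))
        fun a b => a * (starRingEnd ℂ) b
    refine hl.integral_eq_zero (Pi.single j 1) (ω := v.psi i (Pi.single j 1) *
      (starRingEnd ℂ) (v.psi k (Pi.single j 1))) (fun hω => hj ?_) fun x => ?_
    · apply v.psi_single_injective
      have := v.psi_mul_conj k (Pi.single j 1)
      have h0 : (starRingEnd ℂ) (v.psi k (Pi.single j 1)) ≠ 0 := right_ne_zero_of_mul_eq_one this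
      exact mul_right_cancel₀ h0 (hω.trans this.symm)
    · rw [psi_add, psi_add, map_mul]; ring

/-- Vilenkin functions of index at least `M_j` are orthogonal to functions of `j` coordinates. -/
theorem LevelFun.integral_mul_psi {j n : ℕ} (hn : v.M j ≤ n) {g : v.Group → ℂ}
    (hg : LevelFun j g) : ∫ x, g x * v.psi n x ∂v.haar = 0 := by
  obtain ⟨i, hi, hd⟩ : ∃ i, j ≤ i ∧ v.digit n i ≠ 0 := by
    by_contra! h
    have : n = n % v.M j := by
      refine v.eq_of_digit_eq fun i => ?_
      have hb := v.digit_block (n / v.M j) (Nat.mod_lt n (v.M_pos j)) i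
      rw [Nat.div_add_mod'] at hb
      rcases lt_or_ge i j with hij | hij
      · rw [hb, v.digit_mul_M_of_lt _ hij, zero_add]
      · rw [h i hij, v.digit_eq_zero_of_lt_M (Nat.mod_lt n (v.M_pos j)) hij]
    have := Nat.mod_lt n (v.M_pos j)
    omega
  have h1 := v.lt_M n
  have h2 := v.lt_M j
  have hl : LevelFun n fun x => g x * v.psi n x :=
    (hg.mono (by omega)).comp₂ (levelFun_psi h1) (· * ·)
  -- Translation in a coordinate i ≥ j fixes g and multiplies ψ_n by a root of unity, different from
  -- 1 because the i-th digit of n is nonzero.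
  refine hl.integral_eq_zero (Pi.single i 1) (ω := v.psi n (Pi.single i 1)) (fun hω => hd ?_)
    fun x => ?_
  · rw [v.psi_single_injective (i := n) (k := 0) (j := i) (by rw [hω, psi_zero])]
    simp [digit]
  · rw [psi_add, hg (x := x + Pi.single i 1) (y := x) ?_]
    · ring
    · intro l hl
      rw [Pi.add_apply, Pi.single_eq_of_ne (by omega), add_zero]

theorem levelFun_martingale {f : ℕ → v.Group → ℂ} (hf : Martingale f v.filtration v.haar)
    (n : ℕ) : LevelFun n (f n) := levelFun_of_stronglyMeasurable (hf.1 n)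

theorem integral_mul_martingale {f : ℕ → v.Group → ℂ} (hf : Martingale f v.filtration v.haar)
    {i j : ℕ} (hij : i ≤ j) {g : v.Group → ℂ} (hg : LevelFun i g) :
    ∫ x, g x * f j x ∂v.haar = ∫ x, g x * f i x ∂v.haar := by
  have hl : LevelFun j fun x => g x * f j x :=
    (hg.mono hij).comp₂ (levelFun_martingale hf j) (· * ·)
  have h := condExp_bilin_of_stronglyMeasurable_left (ContinuousLinearMap.mul ℝ ℂ)
    hg.stronglyMeasurable (f := g) (g := f j) hl.integrable (hf.integrable j)
  rw [← integral_condExp (v.filtration.le i)]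
  refine integral_congr_ae ?_
  filter_upwards [h, hf.2 i j hij] with x h1 h2
  refine h1.trans ?_
  rw [h2]; rfl

theorem coeff_eq {f : ℕ → v.Group → ℂ} (hf : Martingale f v.filtration v.haar) {k L : ℕ}
    (hk : k < v.M L) : v.coeff f k = ∫ x, f L x * (starRingEnd ℂ) (v.psi k x) ∂v.haar := by
  refine Tendsto.limUnder_eq (tendsto_const_nhds.congr' ?_)
  filter_upwards [eventually_ge_atTop L] with j hj
  have := integral_mul_martingale hf hj ((levelFun_psi hk).comp (starRingEnd ℂ))
  simp only [mul_comm (f _ _)]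
  exact this.symm

variable (v) in
theorem coeff_const (g : v.Group → ℂ) (k : ℕ) :
    v.coeff (fun _ => g) k = ∫ x, g x * (starRingEnd ℂ) (v.psi k x) ∂v.haar :=
  tendsto_const_nhds.limUnder_eq

/-- Only coefficients of index below n ≤ M_L enter, and these are already determined by `f L`; from
here on a single function replaces the martingale. -/
theorem fejer_eq_fejer_const {f : ℕ → v.Group → ℂ} (hf : Martingale f v.filtration v.haar)
    {n L : ℕ} (hn : n ≤ v.M L) : v.fejer n f = v.fejer n fun _ => f L := by
  ext x
  simp only [fejer, partialSum]
  congr 1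
  refine Finset.sum_congr rfl fun i hi => Finset.sum_congr rfl fun k hk => ?_
  rw [Finset.mem_range] at hi hk
  rw [coeff_const, coeff_eq hf (L := L) (by omega)]

theorem levelFun_fejer {n K : ℕ} (hn : n ≤ v.M K) (f : ℕ → v.Group → ℂ) :
    LevelFun K (v.fejer n f) := by
  refine (LevelFun.sum fun i hi => LevelFun.sum fun k hk => ?_).comp ((n : ℂ)⁻¹ * ·)
  rw [Finset.mem_range] at hi hk
  exact (levelFun_psi (by omega)).comp (v.coeff f k * ·)

end VilenkinSeq

/-! ### Elementary inequalities for square roots. -/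

theorem Real.sqrt_add_le_sqrt_add_sqrt {a b : ℝ} (ha : 0 ≤ a) (hb : 0 ≤ b) :
    √(a + b) ≤ √a + √b := by
  refine Real.sqrt_le_iff.2 ⟨by positivity, ?_⟩
  nlinarith [Real.sq_sqrt ha, Real.sq_sqrt hb, mul_nonneg (Real.sqrt_nonneg a) (Real.sqrt_nonneg b)]

theorem Real.sqrt_norm_add_le {E : Type*} [SeminormedAddCommGroup E] (a b : E) :
    √‖a + b‖ ≤ √‖a‖ + √‖b‖ :=
  (Real.sqrt_le_sqrt (norm_add_le a b)).trans
    (Real.sqrt_add_le_sqrt_add_sqrt (norm_nonneg a) (norm_nonneg b))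

theorem Real.sqrt_norm_sum_le {ι E : Type*} [SeminormedAddCommGroup E] (s : Finset ι)
    (a : ι → E) : √‖∑ i ∈ s, a i‖ ≤ ∑ i ∈ s, √‖a i‖ :=
  Finset.le_sum_of_subadditive (fun x : E => √‖x‖) (by simp) Real.sqrt_norm_add_le s a

/-- Plays the role of Hölder's inequality: it turns an L² bound into a bound for ∫√a. For a ≥ T one
has √a ≤ √T (a/T)². -/
theorem Real.sqrt_le_sqrt_add_sq {T a : ℝ} (hT : 0 < T) (ha : 0 ≤ a) :
    √a ≤ √T + √T / T ^ 2 * a ^ 2 := by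
  rcases le_total a T with h | h
  · have := Real.sqrt_le_sqrt h
    have : 0 ≤ √T / T ^ 2 * a ^ 2 := by positivity
    linarith
  · have h2 : √a * √T ≤ a := by
      rw [← Real.sqrt_mul ha]
      exact Real.sqrt_le_iff.2 ⟨ha, by nlinarith⟩
    have h3 : 0 < √T := Real.sqrt_pos.2 hT
    have h4 : √T * √T = T := Real.mul_self_sqrt hT.le
    have h5 : √a ≤ √T / T ^ 2 * a ^ 2 := by
      have h6 : √a ≤ a / √T := (le_div_iff₀ h3).2 h2
      refine h6.trans ?_
      rw [div_le_iff₀ h3]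
      calc a = T * a / T := by field_simp
        _ ≤ a * a / T := by gcongr
        _ = (√T * √T) / T ^ 2 * a ^ 2 := by rw [h4]; field_simp
        _ = _ := by ring
    linarith

/-! ### Fejér means as convolutions, and their L² bound. -/

namespace VilenkinSeq

variable {v : VilenkinSeq}

theorem LevelFun.mul_conj_psi {L n K : ℕ} {g : v.Group → ℂ} (hg : LevelFun L g) (hL : L ≤ K)
    (hn : n < v.M K) : LevelFun K fun x => g x * (starRingEnd ℂ) (v.psi n x) :=
  (hg.mono hL).comp₂ (levelFun_psi hn) fun a b => a * (starRingEnd ℂ) b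

theorem levelFun_fejerSum {n K : ℕ} (hn : n ≤ v.M K) : LevelFun K (v.fejerSum n) :=
  LevelFun.sum fun i hi => LevelFun.sum fun k hk => levelFun_psi (by
    rw [Finset.mem_range] at hi hk; omega)

theorem fejer_const_eq_integral {L : ℕ} {g : v.Group → ℂ} (hg : LevelFun L g) (n : ℕ)
    (x : v.Group) :
    v.fejer n (fun _ => g) x = (n : ℂ)⁻¹ * ∫ t, g t * v.fejerSum n (x - t) ∂v.haar := by
  have hK := v.lt_M (L + n)
  rw [fejer]
  congr 1
  have h1 : ∀ t, g t * v.fejerSum n (x - t) = ∑ i ∈ Finset.range n, ∑ k ∈ Finset.range i,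
      v.psi k x * (g t * (starRingEnd ℂ) (v.psi k t)) := by
    intro t
    simp only [fejerSum, dirichlet, Finset.mul_sum, psi_sub]
    exact Finset.sum_congr rfl fun i _ => Finset.sum_congr rfl fun k _ => by ring
  have h2 : ∀ i ∈ Finset.range n, ∀ k ∈ Finset.range i, LevelFun (L + n)
      fun t => v.psi k x * (g t * (starRingEnd ℂ) (v.psi k t)) := by
    intro i hi k hk
    rw [Finset.mem_range] at hi hk
    exact (hg.mul_conj_psi (K := L + n) (by omega) (by omega)).comp (v.psi k x * ·)
  simp only [h1]
  rw [integral_finsetSum _ fun i hi => (LevelFun.sum (h2 i hi)).integrable]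
  refine Finset.sum_congr rfl fun i hi => ?_
  rw [integral_finsetSum _ fun k hk => (h2 i hi k hk).integrable, partialSum]
  refine Finset.sum_congr rfl fun k _ => ?_
  rw [coeff_const, integral_const_mul, mul_comm]

theorem fejer_const_sum {ι : Type*} {L : ℕ} {s : Finset ι} {g : ι → v.Group → ℂ}
    (hg : ∀ i ∈ s, LevelFun L (g i)) (n : ℕ) (x : v.Group) :
    v.fejer n (fun _ x => ∑ i ∈ s, g i x) x = ∑ i ∈ s, v.fejer n (fun _ => g i) x := by
  rw [fejer_const_eq_integral (LevelFun.sum hg),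
    Finset.sum_congr rfl fun i hi => fejer_const_eq_integral (hg i hi) n x, ← Finset.mul_sum]
  congr 1
  simp only [Finset.sum_mul]
  refine integral_finsetSum _ fun i hi => ?_
  have hK := v.lt_M (L + n)
  have h2 : LevelFun (L + n) fun t => v.fejerSum n (x - t) := by
    intro t t' h
    exact levelFun_fejerSum (K := L + n) (by omega) fun i hi => by
      rw [Pi.sub_apply, Pi.sub_apply, h i hi]
  exact (((hg i hi).mono (by omega)).comp₂ h2 (· * ·)).integrable

/-- All coefficients of g below M_j vanish. This is what later limits the level of an active atom to
a multiple of log n. -/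
theorem fejer_const_eq_zero {j n : ℕ} (hn : n ≤ v.M j) {g : v.Group → ℂ}
    (h0 : ∀ φ : v.Group → ℂ, LevelFun j φ → ∫ x, g x * φ x ∂v.haar = 0) (x : v.Group) :
    v.fejer n (fun _ => g) x = 0 := by
  rw [fejer, Finset.sum_eq_zero, mul_zero]
  intro i hi
  refine Finset.sum_eq_zero fun k hk => ?_
  rw [Finset.mem_range] at hi hk
  rw [coeff_const, h0 _ ((levelFun_psi (K := j) (by omega)).comp (starRingEnd ℂ)), zero_mul]

/-- With P the partial sum, g - P is orthogonal to P, and ‖g‖² ≥ ‖P‖² + 2 Re((g - P) conj P) holds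
pointwise. -/
theorem bessel {L : ℕ} {g : v.Group → ℂ} (hg : LevelFun L g) (n : ℕ) :
    ∫ x, ‖v.partialSum n (fun _ => g) x‖ ^ 2 ∂v.haar ≤ ∫ x, ‖g x‖ ^ 2 ∂v.haar := by
  have hK := v.lt_M (L + n)
  set P := v.partialSum n fun _ => g with hP
  have hPl : LevelFun (L + n) P := LevelFun.sum fun k hk => by
    rw [Finset.mem_range] at hk
    exact (levelFun_psi (by omega)).comp (v.coeff (fun _ => g) k * ·)
  have hgl : LevelFun (L + n) g := hg.mono (by omega)
  have hu : LevelFun (L + n) fun x => g x - P x := hgl.comp₂ hPl (· - ·)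
  have h1 : ∀ k < n, ∫ x, (g x - P x) * (starRingEnd ℂ) (v.psi k x) ∂v.haar = 0 := by
    intro k hk
    simp only [sub_mul]
    rw [integral_sub (hgl.mul_conj_psi le_rfl (by omega)).integrable
      (hPl.mul_conj_psi le_rfl (by omega)).integrable, ← coeff_const, sub_eq_zero]
    simp only [hP, partialSum, Finset.sum_mul, mul_assoc]
    rw [integral_finsetSum]
    · simp only [integral_const_mul, integral_psi_mul_conj]
      simp [hk]
    · intro l hl
      rw [Finset.mem_range] at hl
      exact ((levelFun_psi (K := L + n) (by omega)).mul_conj_psi le_rfl (by omega)).integrable.const_mul _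
  have h2 : ∫ x, (g x - P x) * (starRingEnd ℂ) (P x) ∂v.haar = 0 := by
    have : ∀ x, (g x - P x) * (starRingEnd ℂ) (P x) = ∑ k ∈ Finset.range n,
        (starRingEnd ℂ) (v.coeff (fun _ => g) k) *
          ((g x - P x) * (starRingEnd ℂ) (v.psi k x)) := by
      intro x
      rw [hP, partialSum, map_sum, Finset.mul_sum]
      exact Finset.sum_congr rfl fun k _ => by rw [map_mul]; ring
    simp only [this]
    rw [integral_finsetSum]
    · refine Finset.sum_eq_zero fun k hk => ?_
      rw [integral_const_mul, h1 k (Finset.mem_range.1 hk), mul_zero]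
    · intro k hk
      rw [Finset.mem_range] at hk
      exact (hu.mul_conj_psi le_rfl (by omega)).integrable.const_mul _
  have h3 : ∫ x, ((g x - P x) * (starRingEnd ℂ) (P x)).re ∂v.haar = 0 := by
    have h := integral_re (𝕜 := ℂ) (μ := v.haar)
      (hu.comp₂ hPl fun a b => a * (starRingEnd ℂ) b).integrable
    simp only [RCLike.re_to_complex] at h
    rw [h, h2, Complex.zero_re]
  have h4 : ∀ x, ‖P x‖ ^ 2 + 2 * ((g x - P x) * (starRingEnd ℂ) (P x)).re ≤ ‖g x‖ ^ 2 := by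
    intro x
    rw [← Complex.normSq_eq_norm_sq, ← Complex.normSq_eq_norm_sq, Complex.normSq_apply,
      Complex.normSq_apply]
    simp only [Complex.mul_re, Complex.sub_re, Complex.sub_im, Complex.conj_re, Complex.conj_im]
    nlinarith [sq_nonneg ((g x).re - (P x).re), sq_nonneg ((g x).im - (P x).im)]
  have hi1 : Integrable (fun x => ‖P x‖ ^ 2) v.haar := (hPl.comp fun a => ‖a‖ ^ 2).integrable
  have hi2 : Integrable (fun x => 2 * ((g x - P x) * (starRingEnd ℂ) (P x)).re) v.haar :=
    (hu.comp₂ hPl fun a b => 2 * (a * (starRingEnd ℂ) b).re).integrable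
  calc ∫ x, ‖P x‖ ^ 2 ∂v.haar
      = ∫ x, (‖P x‖ ^ 2 + 2 * ((g x - P x) * (starRingEnd ℂ) (P x)).re) ∂v.haar := by
        rw [integral_add hi1 hi2, integral_const_mul, h3, mul_zero, add_zero]
    _ ≤ _ := integral_mono (hi1.add hi2) (hgl.comp fun a => ‖a‖ ^ 2).integrable h4

theorem integral_fejer_sq_le {L : ℕ} {g : v.Group → ℂ} (hg : LevelFun L g) (n : ℕ) :
    ∫ x, ‖v.fejer n (fun _ => g) x‖ ^ 2 ∂v.haar ≤ ∫ x, ‖g x‖ ^ 2 ∂v.haar := by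
  have hK := v.lt_M (L + n)
  have hI : 0 ≤ ∫ x, ‖g x‖ ^ 2 ∂v.haar := integral_nonneg fun x => by positivity
  rcases Nat.eq_zero_or_pos n with rfl | hn
  · simpa [fejer] using hI
  have hn' : (0 : ℝ) < n := by exact_mod_cast hn
  have hP : ∀ i ∈ Finset.range n, LevelFun (L + n)
      fun x => ‖v.partialSum i (fun _ => g) x‖ ^ 2 := by
    intro i hi
    refine LevelFun.comp (LevelFun.sum fun k hk => ?_) fun a => ‖a‖ ^ 2
    rw [Finset.mem_range] at hi hk
    exact (levelFun_psi (by omega)).comp (v.coeff (fun _ => g) k * ·)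
  have h1 : ∀ x, ‖v.fejer n (fun _ => g) x‖ ^ 2 ≤
      (n : ℝ)⁻¹ * ∑ i ∈ Finset.range n, ‖v.partialSum i (fun _ => g) x‖ ^ 2 := by
    intro x
    have h2 := sq_sum_le_card_mul_sum_sq (s := Finset.range n)
      (f := fun i => ‖v.partialSum i (fun _ => g) x‖)
    have h3 := norm_sum_le (Finset.range n) fun i => v.partialSum i (fun _ => g) x
    rw [Finset.card_range] at h2
    rw [fejer, norm_mul, norm_inv, Complex.norm_natCast, mul_pow]
    calc _ ≤ ((n : ℝ)⁻¹) ^ 2 * (n * ∑ i ∈ Finset.range n,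
          ‖v.partialSum i (fun _ => g) x‖ ^ 2) := by
          gcongr
          exact (pow_le_pow_left₀ (norm_nonneg _) h3 2).trans h2
      _ = _ := by field_simp
  calc _ ≤ ∫ x, (n : ℝ)⁻¹ * ∑ i ∈ Finset.range n,
        ‖v.partialSum i (fun _ => g) x‖ ^ 2 ∂v.haar :=
        integral_mono ((levelFun_fejer (K := L + n) (by omega) _).comp fun a => ‖a‖ ^ 2).integrable
          ((LevelFun.sum hP).integrable.const_mul _) h1
    _ = (n : ℝ)⁻¹ * ∑ i ∈ Finset.range n,
        ∫ x, ‖v.partialSum i (fun _ => g) x‖ ^ 2 ∂v.haar := by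
        rw [integral_const_mul, integral_finsetSum _ fun i hi => (hP i hi).integrable]
    _ ≤ (n : ℝ)⁻¹ * ∑ i ∈ Finset.range n, ∫ x, ‖g x‖ ^ 2 ∂v.haar := by
        exact mul_le_mul_of_nonneg_left (Finset.sum_le_sum fun i _ => bessel hg i) (by positivity)
    _ = _ := by
        rw [Finset.sum_const, Finset.card_range, nsmul_eq_mul]
        field_simp

/-! ### The Fejér mean of one atom. -/

theorem levelFun_mem_interval (n : ℕ) (z : v.Group) : LevelFun n (· ∈ v.interval n z) := by
  intro x y hxy
  exact propext ⟨fun h i hi => (hxy i hi).symm.trans (h i hi),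
    fun h i hi => (hxy i hi).trans (h i hi)⟩

theorem LevelFun.indicator {E : Type*} [Zero E] {n : ℕ} {s : Set v.Group}
    (hs : LevelFun n (· ∈ s)) {g : v.Group → E} (hg : LevelFun n g) :
    LevelFun n (s.indicator g) := by
  classical
  exact hs.comp₂ hg fun p a => if p then a else 0

theorem measurableSet_interval (n : ℕ) (z : v.Group) : MeasurableSet (v.interval n z) :=
  (levelFun_mem_interval n z).measurableSet'

/-- The points that agree with `z` below `l` except possibly at `k`. -/
def punctured (z : v.Group) (k l : ℕ) : Set v.Group :=
  {x | ∀ i ∈ (Finset.range l).erase k, x i = z i}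

theorem levelFun_mem_punctured (z : v.Group) (k l : ℕ) :
    LevelFun l (· ∈ punctured z k l) := by
  intro x y hxy
  have h : ∀ i ∈ (Finset.range l).erase k, x i = y i := fun i hi =>
    hxy i (Finset.mem_range.1 (Finset.mem_of_mem_erase hi))
  exact propext ⟨fun hx i hi => (h i hi).symm.trans (hx i hi),
    fun hx i hi => (h i hi).trans (hx i hi)⟩

theorem measurableSet_punctured (z : v.Group) (k l : ℕ) : MeasurableSet (punctured z k l) :=
  (levelFun_mem_punctured z k l).measurableSet'

theorem haar_real_punctured (z : v.Group) {k l : ℕ} (hkl : k < l) :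
    v.haar.real (punctured z k l) = v.m k / v.M l := by
  have h := Finset.mul_prod_erase (Finset.range l) (fun i => (v.m i : ℝ)⁻¹)
    (Finset.mem_range.2 hkl)
  have hm : (v.m k : ℝ) ≠ 0 := by have := v.two_le k; positivity
  rw [punctured, haar_real_cylinder, M, Nat.cast_prod, div_eq_mul_inv, ← Finset.prod_inv_distrib,
    ← h, ← mul_assoc, mul_inv_cancel₀ hm, one_mul]

/-- M at least doubles and √2 ≥ 4/3, so each term is at most 3 times the drop of 1/√M_l; the sum
telescopes. -/
theorem sum_inv_sqrt_M_le (k N : ℕ) :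
    ∑ l ∈ Finset.Ioc k (k + N), (√(v.M l : ℝ))⁻¹ ≤
      3 * ((√(v.M k : ℝ))⁻¹ - (√(v.M (k + N) : ℝ))⁻¹) := by
  induction N with
  | zero => simp
  | succ N ih =>
    rw [← add_assoc, Finset.sum_Ioc_succ_top (by omega)]
    have h0 : (0 : ℝ) < v.M (k + N) := by exact_mod_cast v.M_pos _
    have h1 : (2 * v.M (k + N) : ℝ) ≤ v.M (k + N + 1) := by exact_mod_cast v.two_mul_M_le _
    have h2 : 4 / 3 * √(v.M (k + N) : ℝ) ≤ √(v.M (k + N + 1) : ℝ) := by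
      refine Real.le_sqrt_of_sq_le ?_
      rw [mul_pow, Real.sq_sqrt h0.le]; linarith
    have h3 : 0 < √(v.M (k + N) : ℝ) := Real.sqrt_pos.2 h0
    have h4 : (√(v.M (k + N + 1) : ℝ))⁻¹ ≤ (4 / 3 * √(v.M (k + N) : ℝ))⁻¹ :=
      inv_anti₀ (by positivity) h2
    rw [mul_inv] at h4
    linarith

theorem norm_fejer_const_le {L N n : ℕ} {g : v.Group → ℂ} (hg : LevelFun L g) {z : v.Group}
    {T : ℝ} (hT : ∀ x, ‖g x‖ ≤ T) (hz : ∀ x ∉ v.interval N z, g x = 0) {x : v.Group} {b : ℝ}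
    (hb : ∀ t ∈ v.interval N z, ‖v.fejerSum n (x - t)‖ ≤ b) :
    ‖v.fejer n (fun _ => g) x‖ ≤ (n : ℝ)⁻¹ * (T * b / v.M N) := by
  rw [fejer_const_eq_integral hg, norm_mul, norm_inv, Complex.norm_natCast]
  gcongr
  have h0 : 0 ≤ T := (norm_nonneg _).trans (hT 0)
  have h1 : LevelFun N ((v.interval N z).indicator fun _ => T * b) :=
    (levelFun_mem_interval N z).indicator (levelFun_const N _)
  refine (norm_integral_le_of_norm_le h1.integrable (ae_of_all _ fun t => ?_)).trans_eq ?_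
  · by_cases ht : t ∈ v.interval N z
    · rw [Set.indicator_of_mem ht, norm_mul]
      have := hT t
      have := hb t ht
      gcongr
    · rw [Set.indicator_of_notMem ht, hz t ht, zero_mul, norm_zero]
  · rw [integral_indicator_const _ (measurableSet_interval N z), haar_real_interval, smul_eq_mul,
      mul_comm, div_eq_mul_inv]

/-- Here k is the first coordinate below N where x leaves z, and l the second one, or N if there is
none. For t in the interval, x - t is nonzero at these same coordinates, so the kernel bounds hold
uniformly in t. -/
theorem sqrt_norm_fejer_const_le {L N n : ℕ} (hn : v.M N < n) {g : v.Group → ℂ}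
    (hg : LevelFun L g) {z : v.Group} {T : ℝ} (hT : ∀ x, ‖g x‖ ≤ T)
    (hz : ∀ x ∉ v.interval N z, g x = 0) {x : v.Group} (hx : x ∉ v.interval N z) :
    ∃ k l, k < l ∧ l ≤ N ∧ x ∈ punctured z k l ∧ √‖v.fejer n (fun _ => g) x‖ ≤
      √(2 * T) * √(v.M (k + 1) : ℝ) * √(v.M (l + 1) : ℝ) / v.M N := by
  classical
  have hT0 : 0 ≤ T := (norm_nonneg _).trans (hT 0)
  have hMN : (0 : ℝ) < v.M N := by exact_mod_cast v.M_pos N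
  have hn0 : (v.M N : ℝ) ≤ n := by exact_mod_cast hn.le
  have hnpos : (0 : ℝ) < n := hMN.trans_le hn0
  have key : ∀ k l : ℕ, ‖v.fejer n (fun _ => g) x‖ ≤
      2 * T * v.M (k + 1) * v.M (l + 1) / (v.M N) ^ 2 → √‖v.fejer n (fun _ => g) x‖ ≤
      √(2 * T) * √(v.M (k + 1) : ℝ) * √(v.M (l + 1) : ℝ) / v.M N := by
    intro k l h
    refine (Real.sqrt_le_sqrt h).trans_eq ?_
    rw [Real.sqrt_div' _ (by positivity), Real.sqrt_sq hMN.le, Real.sqrt_mul (by positivity),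
      Real.sqrt_mul (by positivity)]
  have hsub : ∀ t ∈ v.interval N z, ∀ i < N, x i ≠ z i → (x - t) i ≠ 0 := by
    intro t ht i hi hne
    rw [Pi.sub_apply, ht i hi, sub_ne_zero]
    exact hne
  have hex : ∃ k, k < N ∧ x k ≠ z k := by
    by_contra! h
    exact hx fun i hi => h i hi
  obtain ⟨hkN, hk⟩ := Nat.find_spec hex
  have hkmin : ∀ i, i < Nat.find hex → x i = z i := by
    intro i hi
    by_contra hne
    exact Nat.find_min hex hi ⟨by omega, hne⟩
  set k := Nat.find hex with hkdef
  by_cases hex2 : ∃ l, k < l ∧ l < N ∧ x l ≠ z l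
  · obtain ⟨hkl, hlN, hl⟩ := Nat.find_spec hex2
    have hlmin : ∀ i, k < i → i < Nat.find hex2 → x i = z i := by
      intro i hi hi2
      by_contra hne
      exact Nat.find_min hex2 hi2 ⟨hi, by omega, hne⟩
    set l := Nat.find hex2
    refine ⟨k, l, hkl, hlN.le, fun i hi => ?_, key k l ?_⟩
    · rw [Finset.mem_erase, Finset.mem_range] at hi
      rcases lt_or_gt_of_ne hi.1 with h | h
      · exact hkmin i h
      · exact hlmin i h hi.2
    · refine (norm_fejer_const_le hg hT hz (b := 2 * (v.M (k + 1) * v.M (l + 1)))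
        fun t ht => v.norm_fejerSum_le n hkl (hsub t ht k hkN hk) (hsub t ht l hlN hl)).trans ?_
      calc _ ≤ (v.M N : ℝ)⁻¹ * (T * (2 * (v.M (k + 1) * v.M (l + 1))) / v.M N) := by gcongr
        _ = _ := by field_simp
  -- With a single differing coordinate the kernel is only bounded by n M_{k+1}; the factor n
  -- cancels against 1/n, and l = N fits the common form.
  · push Not at hex2
    refine ⟨k, N, hkN, le_rfl, fun i hi => ?_, key k N ?_⟩
    · rw [Finset.mem_erase, Finset.mem_range] at hi
      rcases lt_or_gt_of_ne hi.1 with h | h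
      · exact hkmin i h
      · exact hex2 i h hi.2
    · refine (norm_fejer_const_le hg hT hz (b := n * v.M (k + 1)) fun t ht =>
        v.norm_fejerSum_le_mul_M n ⟨k, by omega, hsub t ht k hkN hk⟩).trans ?_
      have h1 : (v.M N : ℝ) ≤ 2 * v.M (N + 1) := by
        have h2 : v.M N ≤ v.M (N + 1) := v.M_mono (by omega)
        exact_mod_cast h2.trans (by omega)
      calc _ = T * v.M (k + 1) * v.M N / (v.M N) ^ 2 := by field_simp
        _ ≤ T * v.M (k + 1) * (2 * v.M (N + 1)) / (v.M N) ^ 2 := by gcongr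
        _ = _ := by ring

theorem sqrt_M_succ_le {B : ℕ} (hB : ∀ k, v.m k ≤ B) (k : ℕ) :
    √(v.M (k + 1) : ℝ) ≤ √B * √(v.M k : ℝ) := by
  rw [← Real.sqrt_mul (Nat.cast_nonneg B)]
  refine Real.sqrt_le_sqrt ?_
  rw [M_succ]
  exact_mod_cast Nat.mul_le_mul_right _ (hB k)

/-- On the interval the L² bound is used. Outside, the pointwise bound times the measure of
`punctured z k l` is of order √T √M_k / (√M_l M_N); summing over l > k leaves √T / M_N for each of
the N values of k. -/
theorem integral_sqrt_fejer_atom_le {B : ℕ} (hB : ∀ k, v.m k ≤ B) {L N n : ℕ}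
    {g : v.Group → ℂ} (hg : LevelFun L g) {z : v.Group} {T : ℝ} (hT0 : 0 < T)
    (hT : ∀ x, ‖g x‖ ≤ T) (hz : ∀ x ∉ v.interval N z, g x = 0)
    (h0 : ∀ φ : v.Group → ℂ, LevelFun N φ → ∫ x, g x * φ x ∂v.haar = 0) :
    ∫ x, √‖v.fejer n (fun _ => g) x‖ ∂v.haar ≤
      (2 + 6 * B ^ 2) * (N + 1) * √T * (v.M N : ℝ)⁻¹ := by
  rcases le_or_gt n (v.M N) with hn | hn
  · simp only [fejer_const_eq_zero hn h0, norm_zero, Real.sqrt_zero, integral_zero]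
    positivity
  have hMN : (0 : ℝ) < v.M N := by exact_mod_cast v.M_pos N
  have hK := v.lt_M (L + n + N)
  have hσ : LevelFun (L + n + N) (v.fejer n fun _ => g) := levelFun_fejer (by omega) _
  set σ := v.fejer n fun _ => g
  let loc : v.Group → ℝ := fun x =>
    (v.interval N z).indicator (fun _ => √T) x + √T / T ^ 2 * ‖σ x‖ ^ 2
  -- The bound of `sqrt_norm_fejer_const_le` with both M_{k+1} ≤ B M_k and M_{l+1} ≤ B M_l inserted.
  let a : ℕ → ℕ → ℝ := fun k l =>
    B * √(2 * T) * (√(v.M k : ℝ) * √(v.M l : ℝ)) / v.M N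
  have ha : ∀ k l, 0 ≤ a k l := fun k l => by positivity
  let far : v.Group → ℝ := fun x => ∑ k ∈ Finset.range N, ∑ l ∈ Finset.Ioc k N,
    (punctured z k l).indicator (fun _ => a k l) x
  have hfar0 : ∀ x, 0 ≤ far x := fun x => Finset.sum_nonneg fun k _ => Finset.sum_nonneg
    fun l _ => Set.indicator_nonneg (fun _ _ => ha k l) x
  have hpt : ∀ x, √‖σ x‖ ≤ loc x + far x := by
    intro x
    by_cases hx : x ∈ v.interval N z
    · have h1 := Real.sqrt_le_sqrt_add_sq hT0 (norm_nonneg (σ x))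
      have := hfar0 x
      simp only [loc, Set.indicator_of_mem hx]
      linarith
    · obtain ⟨k, l, hkl, hlN, hxp, hle⟩ := sqrt_norm_fejer_const_le hn hg hT hz hx
      have h1 : √‖σ x‖ ≤ a k l := by
        refine hle.trans ?_
        have hk := sqrt_M_succ_le hB k
        have hl := sqrt_M_succ_le hB l
        have hBB : √(B : ℝ) * √B = B := Real.mul_self_sqrt (Nat.cast_nonneg B)
        calc _ ≤ √(2 * T) * (√B * √(v.M k : ℝ)) * (√B * √(v.M l : ℝ)) / v.M N := by gcongr
          _ = (√(B : ℝ) * √B) * √(2 * T) * (√(v.M k : ℝ) * √(v.M l : ℝ)) / v.M N := by ring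
          _ = _ := by rw [hBB]
      have h2 : a k l ≤ far x := by
        have h3 : (punctured z k l).indicator (fun _ => a k l) x = a k l :=
          Set.indicator_of_mem hxp _
        rw [← h3]
        have h4 : ∀ k l, 0 ≤ (punctured z k l).indicator (fun _ => a k l) x :=
          fun k l => Set.indicator_nonneg (fun _ _ => ha k l) x
        refine le_trans ?_ (Finset.single_le_sum (f := fun k => ∑ l ∈ Finset.Ioc k N,
          (punctured z k l).indicator (fun _ => a k l) x)
          (fun k _ => Finset.sum_nonneg fun l _ => h4 k l)
          (Finset.mem_range.2 (hkl.trans_le hlN)))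
        exact Finset.single_le_sum (f := fun l => (punctured z k l).indicator (fun _ => a k l) x)
          (fun l _ => h4 k l) (Finset.mem_Ioc.2 ⟨hkl, hlN⟩)
      have h3 : 0 ≤ loc x := by
        simp only [loc, Set.indicator_of_notMem hx]
        positivity
      linarith
  have hloc_i : LevelFun (L + n + N) loc :=
    (((levelFun_mem_interval N z).indicator (levelFun_const N _)).mono (by omega)).comp₂ hσ
      fun p s => p + √T / T ^ 2 * ‖s‖ ^ 2
  have hpl : ∀ k ∈ Finset.range N, ∀ l ∈ Finset.Ioc k N,
      LevelFun (L + n + N) ((punctured z k l).indicator fun _ => a k l) := fun k _ l hl =>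
    ((levelFun_mem_punctured z k l).indicator (levelFun_const l _)).mono
      (by rw [Finset.mem_Ioc] at hl; omega)
  have hfar_i : LevelFun (L + n + N) far :=
    LevelFun.sum fun k hk => LevelFun.sum fun l hl => hpl k hk l hl
  have hloc : ∫ x, loc x ∂v.haar ≤ 2 * √T * (v.M N : ℝ)⁻¹ := by
    have h1 : ∫ x, ‖g x‖ ^ 2 ∂v.haar ≤ T ^ 2 * (v.M N : ℝ)⁻¹ := by
      have h2 : LevelFun N ((v.interval N z).indicator fun _ => T ^ 2) :=
        (levelFun_mem_interval N z).indicator (levelFun_const N _)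
      refine (integral_mono (hg.comp fun a => ‖a‖ ^ 2).integrable h2.integrable
        fun x => ?_).trans_eq ?_
      · by_cases hx : x ∈ v.interval N z
        · have := hT x
          simp only [Set.indicator_of_mem hx]
          gcongr
        · simp [Set.indicator_of_notMem hx, hz x hx]
      · rw [integral_indicator_const _ (measurableSet_interval N z), haar_real_interval,
          smul_eq_mul, mul_comm]
    have h2 : ∫ x, ‖σ x‖ ^ 2 ∂v.haar ≤ T ^ 2 * (v.M N : ℝ)⁻¹ :=
      (integral_fejer_sq_le hg n).trans h1
    simp only [loc]
    rw [integral_add ((levelFun_mem_interval N z).indicator (levelFun_const N _)).integrable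
      ((hσ.comp fun a => ‖a‖ ^ 2).integrable.const_mul _), integral_const_mul,
      integral_indicator_const _ (measurableSet_interval N z), haar_real_interval, smul_eq_mul]
    calc _ ≤ (v.M N : ℝ)⁻¹ * √T + √T / T ^ 2 * (T ^ 2 * (v.M N : ℝ)⁻¹) := by gcongr
      _ = _ := by field_simp; ring
  have hfar : ∫ x, far x ∂v.haar ≤ 6 * B ^ 2 * N * √T * (v.M N : ℝ)⁻¹ := by
    have h1 : ∀ k ∈ Finset.range N, ∑ l ∈ Finset.Ioc k N,
        ∫ x, (punctured z k l).indicator (fun _ => a k l) x ∂v.haar ≤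
          6 * B ^ 2 * √T * (v.M N : ℝ)⁻¹ := by
      intro k hk
      rw [Finset.mem_range] at hk
      have hMk : (0 : ℝ) < v.M k := by exact_mod_cast v.M_pos k
      have h2 : ∀ l ∈ Finset.Ioc k N,
          ∫ x, (punctured z k l).indicator (fun _ => a k l) x ∂v.haar ≤
            (B ^ 2 * √(2 * T) * √(v.M k : ℝ) * (v.M N : ℝ)⁻¹) * (√(v.M l : ℝ))⁻¹ := by
        intro l hl
        rw [Finset.mem_Ioc] at hl
        have hMl : (0 : ℝ) < v.M l := by exact_mod_cast v.M_pos l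
        have hMl' : 0 < √(v.M l : ℝ) := Real.sqrt_pos.2 hMl
        have hBk : (v.m k : ℝ) ≤ B := by exact_mod_cast hB k
        rw [integral_indicator_const _ (measurableSet_punctured z k l),
          haar_real_punctured z hl.1, smul_eq_mul]
        calc _ ≤ (B : ℝ) / v.M l * a k l := by
              have := ha k l
              gcongr
          _ = _ := by
              simp only [a]
              field_simp
              rw [Real.sq_sqrt hMl.le]
      refine (Finset.sum_le_sum h2).trans ?_
      rw [← Finset.mul_sum]
      obtain ⟨d, rfl⟩ := Nat.exists_eq_add_of_lt hk
      have h3 := sum_inv_sqrt_M_le (v := v) k (d + 1)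
      rw [← add_assoc] at h3
      have h4 : (0 : ℝ) ≤ (√(v.M (k + d + 1) : ℝ))⁻¹ := by positivity
      have h5 : √(2 * T) ≤ 2 * √T := by
        rw [Real.sqrt_mul (by norm_num)]
        gcongr
        exact Real.sqrt_le_iff.2 ⟨by norm_num, by norm_num⟩
      have h6 : 0 < √(v.M k : ℝ) := Real.sqrt_pos.2 hMk
      calc _ ≤ (B ^ 2 * (2 * √T) * √(v.M k : ℝ) * (v.M (k + d + 1) : ℝ)⁻¹) *
            (3 * (√(v.M k : ℝ))⁻¹) := by
            gcongr
            linarith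
        _ = _ := by field_simp; ring
    simp only [far]
    rw [integral_finsetSum _ fun k hk => (LevelFun.sum (hpl k hk)).integrable]
    rw [Finset.sum_congr rfl fun k hk => integral_finsetSum _ fun l hl => (hpl k hk l hl).integrable]
    refine (Finset.sum_le_sum h1).trans_eq ?_
    rw [Finset.sum_const, Finset.card_range, nsmul_eq_mul]; ring
  calc _ ≤ ∫ x, (loc x + far x) ∂v.haar :=
        integral_mono (hσ.comp fun a => √‖a‖).integrable
          (hloc_i.integrable.add hfar_i.integrable) hpt
    _ = _ := integral_add hloc_i.integrable hfar_i.integrable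
    _ ≤ 2 * √T * (v.M N : ℝ)⁻¹ + 6 * B ^ 2 * N * √T * (v.M N : ℝ)⁻¹ := add_le_add hloc hfar
    _ ≤ _ := by
        have h1 : 0 ≤ √T * (v.M N : ℝ)⁻¹ := by positivity
        have h2 : (0 : ℝ) ≤ N * (√T * (v.M N : ℝ)⁻¹) := by positivity
        have h3 : (0 : ℝ) ≤ B ^ 2 * (√T * (v.M N : ℝ)⁻¹) := by positivity
        linear_combination 2 * h2 + 6 * h3

end VilenkinSeq

/-- A geometric sum is at most twice its last term. The induction carries the bound 2^K s as well,
since it controls the earlier terms whenever the new one is still below b. -/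
theorem Finset.sum_ite_two_pow_mul_lt_le {s b : ℝ} (hs : 0 ≤ s) (hb : 0 ≤ b) (K : ℕ) :
    ∑ k ∈ Finset.range K, (if 2 ^ k * s < b then 2 ^ k * s else 0) ≤ 2 * b := by
  suffices h : ∑ k ∈ Finset.range K, (if 2 ^ k * s < b then 2 ^ k * s else 0) ≤ 2 ^ K * s ∧
      ∑ k ∈ Finset.range K, (if 2 ^ k * s < b then 2 ^ k * s else 0) ≤ 2 * b from h.2
  induction K with
  | zero => simpa using ⟨hs, hb⟩
  | succ K ih =>
    have : (0 : ℝ) ≤ 2 ^ K * s := by positivity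
    rw [Finset.sum_range_succ, pow_succ]
    split_ifs <;> constructor <;> linarith

/-! ### Functions made of atoms of one level. -/

namespace VilenkinSeq

variable {v : VilenkinSeq}

/-- A representative of the interval with first coordinates `w`. -/
def rep (j : ℕ) (w : (i : Fin j) → ZMod (v.m i)) : v.Group :=
  fun i => if h : i < j then w ⟨i, h⟩ else 0

theorem mem_interval_rep {j : ℕ} {w : (i : Fin j) → ZMod (v.m i)} {x : v.Group} :
    x ∈ v.interval j (rep j w) ↔ w = fun i : Fin j => x i := by
  constructor
  · intro h
    ext i
    have := h i i.2
    rw [this]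
    simp [rep]
  · rintro rfl i hi
    simp [rep, hi]

theorem sum_indicator_interval_rep {E : Type*} [AddCommMonoid E] (j : ℕ) (h : v.Group → E)
    (x : v.Group) :
    ∑ w : (i : Fin j) → ZMod (v.m i), (v.interval j (rep j w)).indicator h x = h x := by
  rw [Finset.sum_eq_single fun i : Fin j => x i]
  · exact Set.indicator_of_mem (mem_interval_rep.2 rfl) h
  · exact fun w _ hw => Set.indicator_of_notMem (fun hx => hw (mem_interval_rep.1 hx)) h
  · simp

open scoped Classical in
theorem sum_indicator_interval_rep_filter {E : Type*} [AddCommMonoid E] {j : ℕ}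
    {A : Set v.Group} (hA : LevelFun j (· ∈ A)) {h : v.Group → E} (h0 : ∀ x ∉ A, h x = 0)
    (x : v.Group) :
    ∑ w : (i : Fin j) → ZMod (v.m i) with rep j w ∈ A,
      (v.interval j (rep j w)).indicator h x = h x := by
  rw [← sum_indicator_interval_rep j h x]
  refine Finset.sum_subset (Finset.filter_subset _ _) fun w _ hw => ?_
  rw [Finset.mem_filter, not_and] at hw
  by_cases hx : x ∈ v.interval j (rep j w)
  · rw [Set.indicator_of_mem hx]
    exact h0 x fun hxA => hw (Finset.mem_univ _) ((hA hx).mp hxA)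
  · rw [Set.indicator_of_notMem hx]

open scoped Classical in
theorem haar_real_eq_sum {j : ℕ} {A : Set v.Group} (hA : LevelFun j (· ∈ A)) :
    v.haar.real A = ∑ w : (i : Fin j) → ZMod (v.m i) with rep j w ∈ A, (v.M j : ℝ)⁻¹ := by
  have h1 := sum_indicator_interval_rep_filter hA (h := A.indicator fun _ => (1 : ℝ))
    fun x hx => Set.indicator_of_notMem hx _
  have h2 : v.haar.real A = ∫ x, A.indicator (fun _ => (1 : ℝ)) x ∂v.haar := by
    rw [integral_indicator_const _ (s := A) hA.measurableSet', smul_eq_mul, mul_one]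
  have hl : LevelFun j (A.indicator fun _ => (1 : ℝ)) := hA.indicator (levelFun_const j _)
  rw [h2]
  simp only [← h1]
  rw [integral_finsetSum _ fun w _ => ((levelFun_mem_interval j _).indicator hl).integrable]
  refine Finset.sum_congr rfl fun w hw => ?_
  rw [Finset.mem_filter] at hw
  have h3 : ∫ x, (v.interval j (rep j w)).indicator (fun _ => (1 : ℝ)) x ∂v.haar =
      v.haar.real (v.interval j (rep j w)) := by
    rw [integral_indicator_const _ (measurableSet_interval j (rep j w)), smul_eq_mul, mul_one]
  rw [← v.haar_real_interval j (rep j w), ← h3]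
  refine integral_congr_ae (ae_of_all _ fun x => ?_)
  by_cases hx : x ∈ v.interval j (rep j w)
  · simp only [Set.indicator_of_mem hx]
    rw [Set.indicator_of_mem ((hA hx).mpr hw.2)]
  · simp only [Set.indicator_of_notMem hx]

theorem integral_sqrt_fejer_sum_le {ι : Type*} {L : ℕ} {s : Finset ι} {g : ι → v.Group → ℂ}
    (hg : ∀ i ∈ s, LevelFun L (g i)) (n : ℕ) :
    ∫ x, √‖v.fejer n (fun _ x => ∑ i ∈ s, g i x) x‖ ∂v.haar ≤
      ∑ i ∈ s, ∫ x, √‖v.fejer n (fun _ => g i) x‖ ∂v.haar := by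
  have hK := v.lt_M n
  have hl : ∀ g : v.Group → ℂ, LevelFun n fun x => √‖v.fejer n (fun _ => g) x‖ :=
    fun g => (levelFun_fejer hK.le _).comp fun a => √‖a‖
  rw [← integral_finsetSum _ fun i _ => (hl (g i)).integrable]
  refine integral_mono (hl _).integrable (LevelFun.sum fun i _ => hl (g i)).integrable fun x => ?_
  simp only [fejer_const_sum hg]
  exact Real.sqrt_norm_sum_le _ _

theorem integral_sqrt_fejer_le_of_bounded {L n : ℕ} {g : v.Group → ℂ} (hg : LevelFun L g)
    {T : ℝ} (hT0 : 0 < T) (hT : ∀ x, ‖g x‖ ≤ T) :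
    ∫ x, √‖v.fejer n (fun _ => g) x‖ ∂v.haar ≤ 2 * √T := by
  have hσ := levelFun_fejer (v.lt_M n).le fun _ => g
  have h1 : ∫ x, ‖v.fejer n (fun _ => g) x‖ ^ 2 ∂v.haar ≤ T ^ 2 := by
    refine (integral_fejer_sq_le hg n).trans ?_
    refine (integral_mono (hg.comp fun a => ‖a‖ ^ 2).integrable
      (integrable_const (T ^ 2)) fun x => ?_).trans_eq (by simp)
    have := hT x
    dsimp only
    gcongr
  have h2 := (hσ.comp fun a => ‖a‖ ^ 2).integrable.const_mul (√T / T ^ 2)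
  calc _ ≤ ∫ x, (√T + √T / T ^ 2 * ‖v.fejer n (fun _ => g) x‖ ^ 2) ∂v.haar :=
        integral_mono (hσ.comp fun a => √‖a‖).integrable ((integrable_const _).add h2)
          fun x => Real.sqrt_le_sqrt_add_sq hT0 (norm_nonneg _)
    _ = √T + √T / T ^ 2 * ∫ x, ‖v.fejer n (fun _ => g) x‖ ^ 2 ∂v.haar := by
        rw [integral_add (integrable_const _) h2, integral_const_mul]; simp
    _ ≤ √T + √T / T ^ 2 * T ^ 2 := by gcongr
    _ = _ := by field_simp; ring

/-- A is a disjoint union of intervals of level j, the restriction of g to each is an atom, and √ is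
subadditive; the factors 1/M_j add up to the measure of A. -/
theorem integral_sqrt_fejer_atoms_le {B : ℕ} (hB : ∀ k, v.m k ≤ B) {L j n : ℕ}
    {g : v.Group → ℂ} (hg : LevelFun L g) {T : ℝ} (hT0 : 0 < T) (hT : ∀ x, ‖g x‖ ≤ T)
    {A : Set v.Group} (hA : LevelFun j (· ∈ A)) (hgA : ∀ x ∉ A, g x = 0)
    (h0 : ∀ φ : v.Group → ℂ, LevelFun j φ → ∫ x, g x * φ x ∂v.haar = 0) :
    ∫ x, √‖v.fejer n (fun _ => g) x‖ ∂v.haar ≤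
      (2 + 6 * B ^ 2) * (j + 1) * √T * v.haar.real A := by
  classical
  have h1 : g = fun x => ∑ w : (i : Fin j) → ZMod (v.m i) with rep j w ∈ A,
      (v.interval j (rep j w)).indicator g x :=
    funext fun x => (sum_indicator_interval_rep_filter hA hgA x).symm
  have h2 : ∀ w : (i : Fin j) → ZMod (v.m i),
      LevelFun (L + j) ((v.interval j (rep j w)).indicator g) := fun w =>
    ((levelFun_mem_interval j _).mono (by omega)).indicator (hg.mono (by omega))
  conv_lhs => rw [h1]
  refine (integral_sqrt_fejer_sum_le (fun w _ => h2 w) n).trans ?_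
  rw [haar_real_eq_sum hA, Finset.mul_sum]
  refine Finset.sum_le_sum fun w _ => ?_
  refine integral_sqrt_fejer_atom_le hB (h2 w) (z := rep j w) hT0 (fun x => ?_)
    (fun x hx => Set.indicator_of_notMem hx _) fun φ hφ => ?_
  · exact (norm_indicator_le_norm_self _ _).trans (hT x)
  · rw [← h0 _ ((levelFun_mem_interval j (rep j w)).indicator hφ)]
    refine integral_congr_ae (ae_of_all _ fun x => ?_)
    by_cases hx : x ∈ v.interval j (rep j w)
    · simp [Set.indicator_of_mem hx]
    · simp [Set.indicator_of_notMem hx]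

theorem add_one_le_log {j n : ℕ} (hn : 2 ≤ n) (hj : v.M j < n) : (j + 1 : ℝ) ≤ 3 * Real.log n := by
  have h1 : (2 : ℝ) ^ j ≤ n := by exact_mod_cast (v.two_pow_le_M j).trans hj.le
  have h2 := Real.log_le_log (by positivity) h1
  have h3 : Real.log 2 ≤ Real.log n := Real.log_le_log (by norm_num) (by exact_mod_cast hn)
  have h4 := Real.log_two_gt_d9
  rw [Real.log_pow] at h2
  have h5 : (0 : ℝ) ≤ j := Nat.cast_nonneg j
  nlinarith

/-- Either n ≤ M_j and the mean vanishes, or 2^j ≤ M_j < n bounds j + 1 by 3 log n. -/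
theorem integral_sqrt_fejer_atoms_le_log {B : ℕ} (hB : ∀ k, v.m k ≤ B) {L j n : ℕ} (hn : 2 ≤ n)
    {g : v.Group → ℂ} (hg : LevelFun L g) {T : ℝ} (hT0 : 0 < T) (hT : ∀ x, ‖g x‖ ≤ T)
    {A : Set v.Group} (hA : LevelFun j (· ∈ A)) (hgA : ∀ x ∉ A, g x = 0)
    (h0 : ∀ φ : v.Group → ℂ, LevelFun j φ → ∫ x, g x * φ x ∂v.haar = 0) :
    ∫ x, √‖v.fejer n (fun _ => g) x‖ ∂v.haar ≤
      (2 + 6 * B ^ 2) * (3 * Real.log n) * √T * v.haar.real A := by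
  have hlog : 0 ≤ Real.log n := Real.log_natCast_nonneg n
  rcases le_or_gt n (v.M j) with h | h
  · simp only [fejer_const_eq_zero h h0, norm_zero, Real.sqrt_zero, integral_zero]
    positivity
  · refine (integral_sqrt_fejer_atoms_le hB hg hT0 hT hA hgA h0).trans ?_
    have := add_one_le_log hn h
    gcongr

/-! ### Predictable stopping and the decomposition of a martingale. -/

/-- No value exceeding `t` can occur on the intervals of `x` at the steps `1, …, j + 1`. -/
def Good (f : ℕ → v.Group → ℂ) (t : ℝ) (j : ℕ) (x : v.Group) : Prop :=
  ∀ i ≤ j, ∀ y ∈ v.interval i x, ‖f (i + 1) y‖ ≤ t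

open scoped Classical in
/-- The martingale `f` at time `L`, stopped just before it may exceed `t`. -/
noncomputable def stopped (f : ℕ → v.Group → ℂ) (L : ℕ) (t : ℝ) (x : v.Group) : ℂ :=
  f 0 x + ∑ i ∈ Finset.range L, if Good f t i x then f (i + 1) x - f i x else 0

/-- The points where the process stops at time `j`. -/
def stopSet (f : ℕ → v.Group → ℂ) (t : ℝ) (j : ℕ) : Set v.Group :=
  {x | ¬ Good f t j x ∧ ∀ i < j, Good f t i x}

variable {f : ℕ → v.Group → ℂ}

theorem interval_congr {i : ℕ} {x y : v.Group} (h : ∀ k < i, x k = y k) :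
    v.interval i x = v.interval i y := by
  ext z
  exact ⟨fun hz k hk => (hz k hk).trans (h k hk), fun hz k hk => (hz k hk).trans (h k hk).symm⟩

/-- Since `Good` inspects the whole interval of level j, it is known one step before f_{j+1}.
Stopping can thus act before the threshold is passed, and no overshoot has to be estimated. -/
theorem levelFun_good (f : ℕ → v.Group → ℂ) (t : ℝ) (j : ℕ) : LevelFun j (Good f t j) := by
  intro x y hxy
  refine propext (forall_congr' fun i => forall_congr' fun hi => ?_)
  rw [interval_congr fun k hk => hxy k (hk.trans_le hi)]

theorem Good.anti {t : ℝ} {i j : ℕ} (hij : i ≤ j) {x : v.Group} (h : Good f t j x) :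
    Good f t i x := fun k hk => h k (hk.trans hij)

theorem Good.mono {t t' : ℝ} (ht : t ≤ t') {j : ℕ} {x : v.Group} (h : Good f t j x) :
    Good f t' j x := fun k hk y hy => (h k hk y hy).trans ht

theorem levelFun_stopSet (f : ℕ → v.Group → ℂ) (t : ℝ) (j : ℕ) :
    LevelFun j (· ∈ stopSet f t j) := by
  intro x y hxy
  refine congrArg₂ And (congrArg Not (levelFun_good f t j hxy)) ?_
  exact propext (forall_congr' fun i => forall_congr' fun hi =>
    (((levelFun_good f t i).mono hi.le) hxy).to_iff)

theorem levelFun_stopped (hf : ∀ n, LevelFun n (f n)) (L : ℕ) (t : ℝ) :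
    LevelFun L (stopped f L t) := by
  classical
  refine LevelFun.comp₂ ((hf 0).mono (by omega)) (LevelFun.sum fun i hi => ?_) (· + ·)
  rw [Finset.mem_range] at hi
  have h1 : LevelFun L fun x => f (i + 1) x - f i x :=
    ((hf (i + 1)).mono (by omega)).comp₂ ((hf i).mono (by omega)) (· - ·)
  exact ((levelFun_good f t i).mono (by omega)).comp₂ h1 fun p a => if p then a else 0

theorem exists_stopped_eq (f : ℕ → v.Group → ℂ) (L : ℕ) (t : ℝ) (x : v.Group) :
    ∃ τ ≤ L, stopped f L t x = f τ x ∧ (∀ i < τ, Good f t i x) ∧ (τ < L → ¬ Good f t τ x) := by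
  classical
  induction L with
  | zero => exact ⟨0, le_rfl, by simp [stopped], by simp, by simp⟩
  | succ L ih =>
    obtain ⟨τ, hτ, h1, h2, h3⟩ := ih
    have h4 : stopped f (L + 1) t x =
        stopped f L t x + if Good f t L x then f (L + 1) x - f L x else 0 := by
      rw [stopped, stopped, Finset.sum_range_succ, add_assoc]
    by_cases hg : Good f t L x
    · have hτL : τ = L := by
        by_contra hne
        have : τ < L := by omega
        exact h3 this (hg.anti this.le)
      subst hτL
      refine ⟨τ + 1, le_rfl, ?_, fun i hi => hg.anti (by omega), by simp⟩
      rw [h4, if_pos hg, h1]; ring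
    · refine ⟨τ, by omega, by rw [h4, if_neg hg, add_zero, h1], h2, fun _ => ?_⟩
      rcases hτ.lt_or_eq with h | rfl
      · exact h3 h
      · exact hg

theorem norm_stopped_le {t : ℝ} (h0 : ∀ x, ‖f 0 x‖ ≤ t) (L : ℕ) (x : v.Group) :
    ‖stopped f L t x‖ ≤ t := by
  obtain ⟨τ, -, h1, h2, -⟩ := exists_stopped_eq f L t x
  rw [h1]
  rcases τ with _ | τ
  · exact h0 x
  · exact h2 τ (by omega) τ le_rfl x fun _ _ => rfl

theorem stopped_eq_of_good {L : ℕ} {t : ℝ} {x : v.Group} (h : ∀ i < L, Good f t i x) :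
    stopped f L t x = f L x := by
  obtain ⟨τ, hτ, h1, -, h3⟩ := exists_stopped_eq f L t x
  rcases hτ.lt_or_eq with hlt | rfl
  · exact absurd (h τ hlt) (h3 hlt)
  · exact h1

theorem sum_indicator_stopSet {E : Type*} [AddCommMonoid E] {L : ℕ} {t : ℝ} {h : v.Group → E}
    {x : v.Group} (h0 : (∀ i < L, Good f t i x) → h x = 0) :
    ∑ j ∈ Finset.range L, (stopSet f t j).indicator h x = h x := by
  classical
  by_cases hx : ∃ j, j < L ∧ ¬ Good f t j x
  · obtain ⟨h1, h2⟩ := Nat.find_spec hx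
    have h3 : ∀ i < Nat.find hx, Good f t i x := fun i hi => by
      by_contra h
      exact Nat.find_min hx hi ⟨by omega, h⟩
    rw [Finset.sum_eq_single (Nat.find hx)]
    · exact Set.indicator_of_mem (s := stopSet f t _) ⟨h2, h3⟩ h
    · refine fun j _ hj => Set.indicator_of_notMem (fun hmem => ?_) h
      rcases lt_or_gt_of_ne hj with hlt | hgt
      · exact hmem.1 (h3 j hlt)
      · exact h2 (hmem.2 _ hgt)
    · exact fun h => absurd (Finset.mem_range.2 h1) h
  · push Not at hx
    rw [h0 hx]
    refine Finset.sum_eq_zero fun j hj => Set.indicator_of_notMem (fun hmem => ?_) h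
    exact hmem.1 (hx j (Finset.mem_range.1 hj))

/-- The price of stopping early: each interval of level j in the stop set has a child on which
|f_{j+1}| > t, and this child carries at least 1/B of its measure. Summing over the m_j translations
in coordinate j moves every point of the interval into that child at least once. -/
theorem haar_real_stopSet_le {B : ℕ} (hB : ∀ k, v.m k ≤ B) (hf : ∀ n, LevelFun n (f n))
    (t : ℝ) (j : ℕ) :
    v.haar.real (stopSet f t j) ≤
      B * ∫ x, (stopSet f t j).indicator
        ({x | t < ‖f (j + 1) x‖}.indicator fun _ => (1 : ℝ)) x ∂v.haar := by
  set A := stopSet f t j with hAdef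
  have hA := levelFun_stopSet f t j
  have hS : LevelFun (j + 1) (· ∈ {x | t < ‖f (j + 1) x‖}) := (hf (j + 1)).comp fun a => t < ‖a‖
  set F : v.Group → ℝ := A.indicator ({x | t < ‖f (j + 1) x‖}.indicator fun _ => (1 : ℝ))
  have hF : LevelFun (j + 1) F :=
    (hA.mono (by omega)).indicator (hS.indicator (levelFun_const _ _))
  have hF0 : ∀ x, 0 ≤ F x := fun x =>
    Set.indicator_nonneg (fun x _ => Set.indicator_nonneg (fun _ _ => zero_le_one) x) x
  have hshift : ∀ c : ZMod (v.m j), LevelFun (j + 1) fun x => F (x + (Pi.single j c : v.Group)) :=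
    fun c x y hxy => hF fun i hi => by rw [Pi.add_apply, Pi.add_apply, hxy i hi]
  have hpt : ∀ x, A.indicator (fun _ => (1 : ℝ)) x ≤
      ∑ c : ZMod (v.m j), F (x + (Pi.single j c : v.Group)) := by
    intro x
    by_cases hx : x ∈ A
    · obtain ⟨y, hy, hty⟩ : ∃ y ∈ v.interval j x, t < ‖f (j + 1) y‖ := by
        by_contra! h
        refine hx.1 fun i hi => ?_
        rcases hi.lt_or_eq with hlt | rfl
        · exact hx.2 i hlt i le_rfl
        · exact h
      have h1 : ∀ i < j + 1, (x + (Pi.single j (y j - x j) : v.Group)) i = y i := by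
        intro i hi
        rcases (Nat.lt_succ_iff.1 hi).lt_or_eq with hlt | rfl
        · rw [Pi.add_apply, Pi.single_eq_of_ne (by omega), add_zero, hy i hlt]
        · rw [Pi.add_apply, Pi.single_eq_same]; ring
      have h2 : F (x + (Pi.single j (y j - x j) : v.Group)) = 1 := by
        rw [hF h1]
        have hyA : y ∈ A := (hA fun i hi => hy i hi).mpr hx
        simp only [F]
        rw [Set.indicator_of_mem hyA]
        exact Set.indicator_of_mem (s := {x | t < ‖f (j + 1) x‖}) hty _
      rw [Set.indicator_of_mem hx, ← h2]
      exact Finset.single_le_sum (f := fun c => F (x + (Pi.single j c : v.Group))) (fun c _ => hF0 _)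
        (Finset.mem_univ _)
    · rw [Set.indicator_of_notMem hx]
      exact Finset.sum_nonneg fun c _ => hF0 _
  have h1 : v.haar.real A = ∫ x, A.indicator (fun _ => (1 : ℝ)) x ∂v.haar := by
    rw [integral_indicator_const _ (s := A) hA.measurableSet', smul_eq_mul, mul_one]
  rw [h1]
  calc _ ≤ ∫ x, ∑ c : ZMod (v.m j), F (x + (Pi.single j c : v.Group)) ∂v.haar :=
        integral_mono (hA.indicator (levelFun_const j _)).integrable
          (LevelFun.sum fun c _ => hshift c).integrable hpt
    _ = v.m j * ∫ x, F x ∂v.haar := by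
        rw [integral_finsetSum _ fun c _ => (hshift c).integrable]
        simp only [hF.integral_add_right, Finset.sum_const, Finset.card_univ, ZMod.card,
          nsmul_eq_mul]
    _ ≤ _ := by
        have h2 : (v.m j : ℝ) ≤ B := by exact_mod_cast hB j
        have : 0 ≤ ∫ x, F x ∂v.haar := integral_nonneg hF0
        gcongr

/-- On the stop set the t-process is frozen from time j on, and both processes agree before. What
remains are increments of index i ≥ j with factors known at time i, which gives the cancellation
required of atoms of level j. -/
theorem indicator_stopSet_stopped_sub {t t' : ℝ} (htt : t ≤ t') {L j : ℕ}
    (x : v.Group) : (stopSet f t j).indicator (fun x => stopped f L t' x - stopped f L t x) x =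
      ∑ i ∈ Finset.range L, if j ≤ i then (stopSet f t j).indicator
        ({x | Good f t' i x}.indicator fun x => f (i + 1) x - f i x) x else 0 := by
  classical
  by_cases hx : x ∈ stopSet f t j
  · simp only [Set.indicator_of_mem hx]
    rw [stopped, stopped, add_sub_add_left_eq_sub, ← Finset.sum_sub_distrib]
    refine Finset.sum_congr rfl fun i _ => ?_
    by_cases hij : j ≤ i
    · have h1 : ¬ Good f t i x := fun h => hx.1 (h.anti hij)
      rw [if_neg h1, if_pos hij, sub_zero]
      rfl
    · have h1 : Good f t i x := hx.2 i (by omega)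
      rw [if_pos h1, if_pos (h1.mono htt), if_neg hij, sub_self]
  · simp [Set.indicator_of_notMem hx]

/-- Restricted to each stop set, the difference consists of atoms of size at most 2t'. The stop sets
are disjoint, so the measures supplied by `haar_real_stopSet_le` add up to at most B times that of
{F > t}. -/
theorem integral_sqrt_fejer_stopped_sub_le {B : ℕ} (hB : ∀ k, v.m k ≤ B)
    (hf : Martingale f v.filtration v.haar) {n : ℕ} (hn : 2 ≤ n) {L : ℕ} {F : v.Group → ℝ}
    (hF : LevelFun L F) (hfF : ∀ j ≤ L, ∀ x, ‖f j x‖ ≤ F x) {t t' : ℝ} (ht : 0 < t)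
    (htt : t ≤ t') (h0 : ∀ x, ‖f 0 x‖ ≤ t) :
    ∫ x, √‖v.fejer n (fun _ x => stopped f L t' x - stopped f L t x) x‖ ∂v.haar ≤
      (2 + 6 * B ^ 2) * (3 * Real.log n) * √(2 * t') * B *
        ∫ x, {x | t < F x}.indicator (fun _ => (1 : ℝ)) x ∂v.haar := by
  have hfl := levelFun_martingale hf
  have hlog : 0 ≤ Real.log n := Real.log_natCast_nonneg n
  set g : v.Group → ℂ := fun x => stopped f L t' x - stopped f L t x with hg
  have hgl : LevelFun L g :=
    (levelFun_stopped hfl L t').comp₂ (levelFun_stopped hfl L t) (· - ·)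
  have hsum : g = fun x => ∑ j ∈ Finset.range L, (stopSet f t j).indicator g x := by
    ext x
    rw [sum_indicator_stopSet]
    intro hx
    rw [hg]
    simp only
    rw [stopped_eq_of_good hx, stopped_eq_of_good fun i hi => (hx i hi).mono htt, sub_self]
  have hil : ∀ j ∈ Finset.range L, LevelFun L ((stopSet f t j).indicator g) := fun j hj =>
    ((levelFun_stopSet f t j).mono (Finset.mem_range.1 hj).le).indicator hgl
  have hgT : ∀ x, ‖g x‖ ≤ 2 * t' := fun x => by
    have h1 := norm_stopped_le (fun x => (h0 x).trans htt) L x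
    have h2 := norm_stopped_le h0 L x
    exact (norm_sub_le _ _).trans (by linarith)
  have hS : ∀ j, LevelFun (j + 1) (· ∈ {x | t < ‖f (j + 1) x‖}) :=
    fun j => (hfl (j + 1)).comp fun a => t < ‖a‖
  have hFl : LevelFun L ({x | t < F x}.indicator fun _ => (1 : ℝ)) :=
    LevelFun.indicator (s := {x | t < F x}) (hF.comp fun a => t < a) (levelFun_const L _)
  have hSl : ∀ j ∈ Finset.range L, LevelFun L ((stopSet f t j).indicator
      ({x | t < ‖f (j + 1) x‖}.indicator fun _ => (1 : ℝ))) := by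
    intro j hj
    rw [Finset.mem_range] at hj
    exact ((levelFun_stopSet f t j).mono hj.le).indicator
      (((hS j).mono hj).indicator (levelFun_const _ _))
  conv_lhs => rw [hsum]
  refine (integral_sqrt_fejer_sum_le hil n).trans ?_
  set c := (2 + 6 * (B : ℝ) ^ 2) * (3 * Real.log n) * √(2 * t') with hc
  have hc0 : 0 ≤ c := by positivity
  calc _ ≤ ∑ j ∈ Finset.range L, c * (B * ∫ x, (stopSet f t j).indicator
        ({x | t < ‖f (j + 1) x‖}.indicator fun _ => (1 : ℝ)) x ∂v.haar) := by
        refine Finset.sum_le_sum fun j hj => ?_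
        refine (integral_sqrt_fejer_atoms_le_log hB hn (hil j hj) (T := 2 * t') (by linarith)
          (fun x => (norm_indicator_le_norm_self _ _).trans (hgT x)) (levelFun_stopSet f t j)
          (fun x hx => Set.indicator_of_notMem hx _) fun φ hφ => ?_).trans
          (mul_le_mul_of_nonneg_left (haar_real_stopSet_le hB hfl t j) hc0)
        have hterm : ∀ i ∈ Finset.range L, LevelFun L fun x => (if j ≤ i then
            (stopSet f t j).indicator ({x | Good f t' i x}.indicator
              fun x => f (i + 1) x - f i x) x else 0) * φ x := by
          intro i hi
          rw [Finset.mem_range] at hi hj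
          split_ifs with hij
          · have h1 : LevelFun L fun x => f (i + 1) x - f i x :=
              ((hfl (i + 1)).mono hi).comp₂ ((hfl i).mono hi.le) (· - ·)
            exact (((levelFun_stopSet f t j).mono hj.le).indicator (LevelFun.indicator
              (s := {x | Good f t' i x}) ((levelFun_good f t' i).mono hi.le) h1)).comp₂
              (hφ.mono hj.le) (· * ·)
          · simpa using levelFun_const L (0 : ℂ)
        simp only [g, indicator_stopSet_stopped_sub htt, Finset.sum_mul]
        rw [integral_finsetSum _ fun i hi => (hterm i hi).integrable]
        refine Finset.sum_eq_zero fun i hi => ?_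
        by_cases hij : j ≤ i
        -- Predictability enters here: the factor of the i-th increment depends on i coordinates
        -- only, so the martingale property makes the integral vanish.
        · have hχ : LevelFun i ((stopSet f t j).indicator ({x | Good f t' i x}.indicator φ)) :=
            ((levelFun_stopSet f t j).mono hij).indicator (LevelFun.indicator
              (s := {x | Good f t' i x}) (levelFun_good f t' i) (hφ.mono hij))
          have h1 := integral_mul_martingale hf (Nat.le_succ i) hχ
          rw [← sub_eq_zero, ← integral_sub ((hχ.mono (Nat.le_succ i)).comp₂ (hfl (i + 1))
            (· * ·)).integrable (hχ.comp₂ (hfl i) (· * ·)).integrable] at h1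
          rw [← h1]
          refine integral_congr_ae (ae_of_all _ fun x => ?_)
          simp only [if_pos hij]
          by_cases hx : x ∈ stopSet f t j
          · by_cases hx' : x ∈ {x | Good f t' i x}
            · simp only [Set.indicator_of_mem hx, Set.indicator_of_mem hx']; ring
            · simp only [Set.indicator_of_mem hx, Set.indicator_of_notMem hx']; ring
          · simp only [Set.indicator_of_notMem hx]; ring
        · simp [if_neg hij]
    _ = c * B * ∫ x, ∑ j ∈ Finset.range L, (stopSet f t j).indicator
        ({x | t < ‖f (j + 1) x‖}.indicator fun _ => (1 : ℝ)) x ∂v.haar := by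
        rw [integral_finsetSum _ fun j hj => (hSl j hj).integrable, Finset.mul_sum]
        exact Finset.sum_congr rfl fun j _ => by ring
    _ ≤ _ := by
        refine mul_le_mul_of_nonneg_left (integral_mono (LevelFun.sum hSl).integrable
          hFl.integrable fun x => ?_) (by positivity)
        have h2 : ∀ j ∈ Finset.range L, (stopSet f t j).indicator
            ({x | t < ‖f (j + 1) x‖}.indicator fun _ => (1 : ℝ)) x ≤
            (stopSet f t j).indicator ({x | t < F x}.indicator fun _ => (1 : ℝ)) x := by
          intro j hj
          refine Set.indicator_le_indicator ?_
          refine Set.indicator_le_indicator_of_subset (fun y hy => ?_) (fun _ => zero_le_one) x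
          exact lt_of_lt_of_le hy (hfF _ (Finset.mem_range.1 hj) y)
        refine (Finset.sum_le_sum h2).trans ?_
        by_cases hx : ∀ i < L, Good f t i x
        · have h3 : ∑ j ∈ Finset.range L, (stopSet f t j).indicator
              ({x | t < F x}.indicator fun _ => (1 : ℝ)) x = 0 :=
            Finset.sum_eq_zero fun j hj =>
              Set.indicator_of_notMem (fun h => h.1 (hx j (Finset.mem_range.1 hj))) _
          rw [h3]
          exact Set.indicator_nonneg (fun _ _ => zero_le_one) x
        · rw [sum_indicator_stopSet fun h => absurd h hx]

/-- Telescoping over the thresholds 4^k ε gives a sum of √(4^{k+1} ε) times the measure of {F > 4^k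
ε}, which is comparable to ∫√F. -/
theorem integral_sqrt_fejer_le {B : ℕ} (hB : ∀ k, v.m k ≤ B)
    (hf : Martingale f v.filtration v.haar) {n : ℕ} (hn : 2 ≤ n) {L : ℕ} {F : v.Group → ℝ}
    (hF : LevelFun L F) (hfF : ∀ j ≤ L, ∀ x, ‖f j x‖ ≤ F x) :
    ∫ x, √‖v.fejer n (fun _ => f L) x‖ ∂v.haar ≤
      (4 + 18 * B * (2 + 6 * B ^ 2)) * Real.log n * ∫ x, √(F x) ∂v.haar := by
  have hfl := levelFun_martingale hf
  have hF0 : ∀ x, 0 ≤ F x := fun x => (norm_nonneg _).trans (hfF 0 (by omega) x)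
  have hlog2 : 1 ≤ 2 * Real.log n := by
    have h3 : Real.log 2 ≤ Real.log n := Real.log_le_log (by norm_num) (by exact_mod_cast hn)
    have h4 := Real.log_two_gt_d9
    linarith
  have hsF : LevelFun L fun x => √(F x) := hF.comp Real.sqrt
  have hI : 0 ≤ ∫ x, √(F x) ∂v.haar := integral_nonneg fun x => Real.sqrt_nonneg _
  refine le_of_forall_pos_le_add fun η hη => ?_
  -- The lowest threshold must dominate the constant |f_0| and be positive. The extra (η/2)² costs
  -- only η in the bounded term 2√ε.
  set ε := ‖f 0 0‖ + (η / 2) ^ 2 with hε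
  have hε0 : 0 < ε := by positivity
  have h00 : ∀ x, f 0 x = f 0 0 := fun x => hfl 0 fun i hi => absurd hi (by omega)
  have hεt : ∀ k : ℕ, ε ≤ 4 ^ k * ε := fun k =>
    le_mul_of_one_le_left hε0.le (one_le_pow₀ (by norm_num))
  have h0 : ∀ (k : ℕ) x, ‖f 0 x‖ ≤ 4 ^ k * ε := fun k x => by
    rw [h00]
    refine le_trans ?_ (hεt k)
    rw [hε]
    linarith [sq_nonneg (η / 2)]
  have hsε : √ε ≤ (∫ x, √(F x) ∂v.haar) + η / 2 := by
    refine (Real.sqrt_add_le_sqrt_add_sqrt (norm_nonneg _) (sq_nonneg _)).trans ?_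
    rw [Real.sqrt_sq (by positivity)]
    have h1 : ∫ _, √‖f 0 0‖ ∂v.haar ≤ ∫ x, √(F x) ∂v.haar :=
      integral_mono (integrable_const _) hsF.integrable fun x => Real.sqrt_le_sqrt (by
        rw [← h00 x]
        exact hfF 0 (by omega) x)
    have h2 : ∫ _, √‖f 0 0‖ ∂v.haar = √‖f 0 0‖ := by simp
    linarith
  obtain ⟨C, hC⟩ := hF.finite_range.bddAbove
  -- F stays below 4^K ε, so nothing is stopped at the last threshold and the telescoping sum ends
  -- at `f L`.
  obtain ⟨K, hK⟩ := pow_unbounded_of_one_lt (C / ε) (by norm_num : (1 : ℝ) < 4)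
  rw [div_lt_iff₀ hε0] at hK
  set s := stopped f L with hs
  have hsl := levelFun_stopped hfl L
  have htop : f L = fun x => s (4 ^ 0 * ε) x +
      ∑ k ∈ Finset.range K, (s (4 ^ (k + 1) * ε) x - s (4 ^ k * ε) x) := by
    ext x
    rw [Finset.sum_range_sub (fun k => s (4 ^ k * ε) x), add_sub_cancel, hs,
      stopped_eq_of_good fun i hi j hj y _ => ?_]
    exact (hfF _ (by omega) y).trans ((hC ⟨y, rfl⟩).trans hK.le)
  set c := (2 + 6 * (B : ℝ) ^ 2) * (3 * Real.log n) with hc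
  have hc0 : 0 ≤ c := by positivity
  have hdl : ∀ k ∈ Finset.range K,
      LevelFun L fun x => s (4 ^ (k + 1) * ε) x - s (4 ^ k * ε) x :=
    fun k _ => (hsl _).comp₂ (hsl _) (· - ·)
  have hind : ∀ k ∈ Finset.range K, LevelFun L fun x =>
      √(2 * (4 ^ (k + 1) * ε)) * {x | 4 ^ k * ε < F x}.indicator (fun _ => (1 : ℝ)) x :=
    fun k _ => (LevelFun.indicator (s := {x | 4 ^ k * ε < F x})
      (hF.comp fun a => 4 ^ k * ε < a) (levelFun_const L (1 : ℝ))).comp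
      (√(2 * (4 ^ (k + 1) * ε)) * ·)
  have hsplit : ∫ x, √‖v.fejer n (fun _ => f L) x‖ ∂v.haar ≤
      ∫ x, √‖v.fejer n (fun _ => s (4 ^ 0 * ε)) x‖ ∂v.haar + ∑ k ∈ Finset.range K,
        ∫ x, √‖v.fejer n (fun _ x => s (4 ^ (k + 1) * ε) x - s (4 ^ k * ε) x) x‖ ∂v.haar := by
    have h1 : f L = fun x => ∑ o ∈ Finset.range (K + 1), (match o with
        | 0 => fun x => s (4 ^ 0 * ε) x
        | k + 1 => fun x => s (4 ^ (k + 1) * ε) x - s (4 ^ k * ε) x : v.Group → ℂ) x := by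
      rw [htop]
      ext x
      rw [Finset.sum_range_succ']
      exact add_comm _ _
    conv_lhs => rw [h1]
    refine (integral_sqrt_fejer_sum_le (L := L) (fun o ho => ?_) n).trans_eq ?_
    · rcases o with _ | k
      · exact hsl _
      · exact hdl k (by simpa using ho)
    · rw [Finset.sum_range_succ']
      exact add_comm _ _
  -- √(2·4^{k+1} ε) = √8 · 2^k √ε ≤ 3 · 2^k √ε, and the truncated geometric sum contributes the
  -- factor 2.
  have hpt : ∀ x, ∑ k ∈ Finset.range K, √(2 * (4 ^ (k + 1) * ε)) *
      {x | 4 ^ k * ε < F x}.indicator (fun _ => (1 : ℝ)) x ≤ 6 * √(F x) := by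
    intro x
    have h1 := Finset.sum_ite_two_pow_mul_lt_le (Real.sqrt_nonneg ε) (Real.sqrt_nonneg (F x)) K
    have h2 : ∀ k ∈ Finset.range K, √(2 * (4 ^ (k + 1) * ε)) *
        {x | 4 ^ k * ε < F x}.indicator (fun _ => (1 : ℝ)) x ≤
        3 * if 2 ^ k * √ε < √(F x) then 2 ^ k * √ε else 0 := by
      intro k _
      have h4 : √((4 : ℝ) ^ k * ε) = 2 ^ k * √ε := by
        rw [Real.sqrt_mul (by positivity), show (4 : ℝ) ^ k = (2 ^ k) ^ 2 by
          rw [← pow_mul, mul_comm, pow_mul]; norm_num, Real.sqrt_sq (by positivity)]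
      by_cases hx : 4 ^ k * ε < F x
      · have h3 : 2 ^ k * √ε < √(F x) := by
          rw [← h4]
          exact Real.sqrt_lt_sqrt (by positivity) hx
        have hx' : x ∈ {x | 4 ^ k * ε < F x} := hx
        rw [Set.indicator_of_mem hx', if_pos h3, mul_one, ← h4,
          show 2 * (4 ^ (k + 1) * ε) = 8 * (4 ^ k * ε) by ring, Real.sqrt_mul (by norm_num)]
        gcongr
        exact Real.sqrt_le_iff.2 ⟨by norm_num, by norm_num⟩
      · have hx' : x ∉ {x | 4 ^ k * ε < F x} := hx
        rw [Set.indicator_of_notMem hx', mul_zero]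
        split_ifs <;> positivity
    refine (Finset.sum_le_sum h2).trans ?_
    rw [← Finset.mul_sum]
    linarith
  have hbase : ∫ x, √‖v.fejer n (fun _ => s (4 ^ 0 * ε)) x‖ ∂v.haar ≤ 2 * √ε := by
    have := integral_sqrt_fejer_le_of_bounded (n := n) (hsl (4 ^ 0 * ε)) (T := 4 ^ 0 * ε)
      (by positivity) (norm_stopped_le (h0 0) L)
    simpa using this
  have hrest : ∑ k ∈ Finset.range K, ∫ x, √‖v.fejer n
      (fun _ x => s (4 ^ (k + 1) * ε) x - s (4 ^ k * ε) x) x‖ ∂v.haar ≤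
      c * B * (6 * ∫ x, √(F x) ∂v.haar) := by
    calc _ ≤ ∑ k ∈ Finset.range K, c * B * ∫ x, √(2 * (4 ^ (k + 1) * ε)) *
          {x | 4 ^ k * ε < F x}.indicator (fun _ => (1 : ℝ)) x ∂v.haar := by
          refine Finset.sum_le_sum fun k _ => ?_
          refine (integral_sqrt_fejer_stopped_sub_le hB hf hn hF hfF (t := 4 ^ k * ε)
            (by positivity) ?_ (h0 k)).trans_eq ?_
          · have := hεt k
            rw [pow_succ]; linarith
          · rw [integral_const_mul]; ring
      _ = c * B * ∫ x, ∑ k ∈ Finset.range K, √(2 * (4 ^ (k + 1) * ε)) *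
          {x | 4 ^ k * ε < F x}.indicator (fun _ => (1 : ℝ)) x ∂v.haar := by
          rw [integral_finsetSum _ fun k hk => (hind k hk).integrable, Finset.mul_sum]
      _ ≤ c * B * ∫ x, 6 * √(F x) ∂v.haar :=
          mul_le_mul_of_nonneg_left (integral_mono (LevelFun.sum hind).integrable
            (hsF.integrable.const_mul 6) hpt) (by positivity)
      _ = _ := by rw [integral_const_mul]
  have h5 : 2 * ∫ x, √(F x) ∂v.haar ≤ 4 * Real.log n * ∫ x, √(F x) ∂v.haar := by
    have := mul_le_mul_of_nonneg_right hlog2 hI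
    linarith
  calc _ ≤ 2 * √ε + c * B * (6 * ∫ x, √(F x) ∂v.haar) :=
        hsplit.trans (add_le_add hbase hrest)
    _ ≤ 4 * Real.log n * (∫ x, √(F x) ∂v.haar) + η + c * B * (6 * ∫ x, √(F x) ∂v.haar) := by
        linarith
    _ = _ := by rw [hc]; ring

end VilenkinSeq

/-! ### Part a) in terms of the quasi-norms. -/

theorem MeasureTheory.eLpNorm_half_rpow_half {α E : Type*} [MeasurableSpace α]
    [TopologicalSpace E] [ContinuousENorm E] (g : α → E) (μ : Measure α) :
    eLpNorm g (1 / 2) μ ^ (1 / 2 : ℝ) = ∫⁻ x, ‖g x‖ₑ ^ (1 / 2 : ℝ) ∂μ := by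
  have h : (1 / 2 : ℝ≥0∞).toReal = 1 / 2 := by simp
  rw [eLpNorm_eq_lintegral_rpow_enorm_toReal (by simp) (by simp), h, ← ENNReal.rpow_mul]
  norm_num

theorem Complex.enorm_rpow_half (z : ℂ) : ‖z‖ₑ ^ (1 / 2 : ℝ) = ENNReal.ofReal √‖z‖ := by
  rw [Real.sqrt_eq_rpow, ← ENNReal.ofReal_rpow_of_nonneg (norm_nonneg z) (by norm_num),
    ofReal_norm]

namespace VilenkinSeq

variable {v : VilenkinSeq}

theorem eLpNorm_rpow_half_eq {n : ℕ} {g : v.Group → ℂ} (hg : LevelFun n g) :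
    eLpNorm g (1 / 2) v.haar ^ (1 / 2 : ℝ) = ENNReal.ofReal (∫ x, √‖g x‖ ∂v.haar) := by
  rw [eLpNorm_half_rpow_half, ofReal_integral_eq_lintegral_ofReal
    (hg.comp fun a => √‖a‖).integrable (ae_of_all _ fun x => Real.sqrt_nonneg _)]
  simp only [Complex.enorm_rpow_half]

theorem eLpNorm_fejer_le {B : ℕ} (hB : ∀ k, v.m k ≤ B) {f : ℕ → v.Group → ℂ}
    (hf : Martingale f v.filtration v.haar) {n : ℕ} (hn : 2 ≤ n) :
    eLpNorm (v.fejer n f) (1 / 2) v.haar ^ (1 / 2 : ℝ) ≤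
      ENNReal.ofReal ((4 + 18 * B * (2 + 6 * B ^ 2)) * Real.log n) *
        v.hardyNorm f (1 / 2) ^ (1 / 2 : ℝ) := by
  have hfl := levelFun_martingale hf
  have hL := v.lt_M n
  let F : v.Group → ℝ := fun x =>
    (Finset.range (n + 1)).sup' ⟨0, by simp⟩ fun j => ‖f j x‖
  have hF : LevelFun n F := fun x y hxy => Finset.sup'_congr _ rfl fun j hj => by
    rw [((hfl j).mono (Nat.lt_succ_iff.1 (Finset.mem_range.1 hj))) hxy]
  have hfF : ∀ j ≤ n, ∀ x, ‖f j x‖ ≤ F x := fun j hj x =>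
    Finset.le_sup' (fun j => ‖f j x‖) (Finset.mem_range.2 (Nat.lt_succ_of_le hj))
  have hlog : 0 ≤ Real.log n := Real.log_natCast_nonneg n
  have h1 : ENNReal.ofReal (∫ x, √(F x) ∂v.haar) ≤ v.hardyNorm f (1 / 2) ^ (1 / 2 : ℝ) := by
    rw [hardyNorm, eLpNorm_half_rpow_half, ofReal_integral_eq_lintegral_ofReal
      (hF.comp Real.sqrt).integrable (ae_of_all _ fun x => Real.sqrt_nonneg _)]
    refine lintegral_mono fun x => ?_
    obtain ⟨j, -, hj⟩ := Finset.exists_mem_eq_sup' (s := Finset.range (n + 1)) ⟨0, by simp⟩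
      fun j => ‖f j x‖
    have hj' : F x = ‖f j x‖ := hj
    rw [hj', ← Complex.enorm_rpow_half, enorm_eq_self]
    exact ENNReal.rpow_le_rpow (le_iSup (fun n => ‖f n x‖ₑ) j) (by norm_num)
  rw [fejer_eq_fejer_const hf hL.le, eLpNorm_rpow_half_eq (levelFun_fejer hL.le _)]
  refine (ENNReal.ofReal_le_ofReal (integral_sqrt_fejer_le hB hf hn hF hfF)).trans ?_
  rw [ENNReal.ofReal_mul (by positivity)]
  gcongr

theorem strong_summability {B : ℕ} (hB : ∀ k, v.m k ≤ B) {f : ℕ → v.Group → ℂ}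
    (hf : Martingale f v.filtration v.haar) {n : ℕ} (hn : 2 ≤ n) :
    (ENNReal.ofReal (n * Real.log n))⁻¹ *
      ∑ k ∈ Finset.Icc 1 n, eLpNorm (v.fejer k f) (1 / 2) v.haar ^ (1 / 2 : ℝ) ≤
      ENNReal.ofReal (4 + 18 * B * (2 + 6 * B ^ 2)) * v.hardyNorm f (1 / 2) ^ (1 / 2 : ℝ) := by
  have hn0 : (0 : ℝ) < n := by exact_mod_cast (by omega : 0 < n)
  have hlog : 0 < Real.log n := Real.log_pos (by exact_mod_cast hn)
  have h1 : ∀ k ∈ Finset.Icc 1 n, eLpNorm (v.fejer k f) (1 / 2) v.haar ^ (1 / 2 : ℝ) ≤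
      ENNReal.ofReal ((4 + 18 * B * (2 + 6 * B ^ 2)) * Real.log n) *
        v.hardyNorm f (1 / 2) ^ (1 / 2 : ℝ) := by
    intro k hk
    rw [Finset.mem_Icc] at hk
    rcases Nat.lt_or_ge k 2 with h | h
    · obtain rfl : k = 1 := by omega
      -- σ_1 f = S_0 f = 0 covers the index that `eLpNorm_fejer_le` excludes.
      have : v.fejer 1 f = fun _ => 0 := by
        ext x; simp [fejer, partialSum]
      rw [this]
      simp
    · refine (eLpNorm_fejer_le hB hf h).trans ?_
      have h2 : Real.log k ≤ Real.log n :=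
        Real.log_le_log (by exact_mod_cast (by omega : 0 < k)) (by exact_mod_cast hk.2)
      gcongr
  have h2 := Finset.sum_le_card_nsmul _ _ _ h1
  rw [Nat.card_Icc, Nat.add_sub_cancel, nsmul_eq_mul] at h2
  have h3 : ENNReal.ofReal (n * Real.log n) ≠ 0 := by
    rw [ne_eq, ENNReal.ofReal_eq_zero, not_le]; positivity
  calc _ ≤ (ENNReal.ofReal (n * Real.log n))⁻¹ * (n * (ENNReal.ofReal
        ((4 + 18 * B * (2 + 6 * B ^ 2)) * Real.log n) *
        v.hardyNorm f (1 / 2) ^ (1 / 2 : ℝ))) := by gcongr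
    _ = (ENNReal.ofReal (n * Real.log n))⁻¹ * ENNReal.ofReal (n * Real.log n) *
        (ENNReal.ofReal (4 + 18 * B * (2 + 6 * B ^ 2)) *
          v.hardyNorm f (1 / 2) ^ (1 / 2 : ℝ)) := by
        rw [ENNReal.ofReal_mul hn0.le, ENNReal.ofReal_mul (by positivity), ENNReal.ofReal_natCast]
        ring
    _ = _ := by rw [ENNReal.inv_mul_cancel h3 ENNReal.ofReal_ne_top, one_mul]

end VilenkinSeq

/-! ### Lower bounds for the kernels on average. -/

theorem Finset.mul_le_sum_range_mul {u : ℕ → ℝ} {c : ℝ} {P : ℕ}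
    (h : ∀ a, c ≤ ∑ s ∈ Finset.range P, u (a * P + s)) (Q : ℕ) :
    Q * c ≤ ∑ j ∈ Finset.range (Q * P), u j := by
  induction Q with
  | zero => simp
  | succ Q ih =>
    rw [add_mul, one_mul, Finset.sum_range_add]
    push_cast
    linarith [h Q]

namespace VilenkinSeq

variable {v : VilenkinSeq}

/-- Pairing s with h + s cancels the unknown contribution of the preceding blocks. The difference
has modulus h s + h(h-1)/2 ≥ h²/4, so the two square roots add up to at least h/2. -/
theorem le_sum_sqrt_norm_fejerSum_block {k : ℕ} (hk : 2 ≤ k) {x : v.Group}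
    (hx : ∀ i < k, x i = 0) (hxk : x k ≠ 0) (a : ℕ) :
    (v.M k : ℝ) ^ 2 / 32 ≤
      ∑ s ∈ Finset.range (v.M (k + 1)), √‖v.fejerSum (a * v.M (k + 1) + s) x‖ := by
  have hM4 : 4 ≤ v.M k := (Nat.pow_le_pow_right (by norm_num) hk).trans (v.two_pow_le_M k)
  have hMM := v.two_mul_M_le k
  -- k ≥ 2 gives M_k ≥ 4, hence h ≥ 2. Both s and h + s stay below M_k, where the kernel at x is
  -- explicit.
  set h := v.M k / 2 with hh
  have hhM : (v.M k : ℝ) ≤ 4 * h := by exact_mod_cast (by omega : v.M k ≤ 4 * h)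
  have hh2 : (2 : ℝ) ≤ h := by exact_mod_cast (by omega : 2 ≤ h)
  set u : ℕ → ℝ := fun s => √‖v.fejerSum (a * v.M (k + 1) + s) x‖
  have hpair : ∀ s ∈ Finset.range h, (h : ℝ) / 2 ≤ u s + u (h + s) := by
    intro s hs
    rw [Finset.mem_range] at hs
    have hx' : ∃ i < k + 1, x i ≠ 0 := ⟨k, by omega, hxk⟩
    have h1 := v.fejerSum_block a (s := s) (k := k + 1) (by omega) hx'
    have h2 := v.fejerSum_block a (s := h + s) (k := k + 1) (by omega) hx'
    rw [v.fejerSum_of_le (n := s) (k := k) (by omega) hx] at h1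
    rw [v.fejerSum_of_le (n := h + s) (k := k) (by omega) hx] at h2
    have h3 : v.psi (a * v.M (k + 1)) x * ((h * s + h * (h - 1) / 2 : ℝ) : ℂ) =
        v.fejerSum (a * v.M (k + 1) + (h + s)) x + -v.fejerSum (a * v.M (k + 1) + s) x := by
      rw [h1, h2]; push_cast; ring
    have h4 := Real.sqrt_norm_add_le (v.fejerSum (a * v.M (k + 1) + (h + s)) x)
      (-v.fejerSum (a * v.M (k + 1) + s) x)
    have hs0 : (0 : ℝ) ≤ s := Nat.cast_nonneg s
    rw [← h3, norm_neg, norm_mul, norm_psi, one_mul, Complex.norm_real, Real.norm_eq_abs,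
      abs_of_nonneg (by nlinarith)] at h4
    have h5 : (h : ℝ) / 2 ≤ √(h * s + h * (h - 1) / 2) := Real.le_sqrt_of_sq_le (by nlinarith)
    calc _ ≤ _ := h5
      _ ≤ _ := h4
      _ = _ := add_comm _ _
  calc (v.M k : ℝ) ^ 2 / 32 ≤ ∑ _s ∈ Finset.range h, (h : ℝ) / 2 := by
        rw [Finset.sum_const, Finset.card_range, nsmul_eq_mul]
        nlinarith
    _ ≤ ∑ s ∈ Finset.range h, (u s + u (h + s)) := Finset.sum_le_sum hpair
    _ = ∑ s ∈ Finset.range (h + h), u s := by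
        rw [Finset.sum_range_add, Finset.sum_add_distrib]
    _ ≤ _ := Finset.sum_le_sum_of_subset_of_nonneg (Finset.range_subset_range.2 (by omega))
        fun _ _ _ => Real.sqrt_nonneg _

theorem le_sum_sqrt_norm_fejerSum {B : ℕ} (hB : ∀ k, v.m k ≤ B) {k N : ℕ} (hk : 2 ≤ k)
    (hkN : k < N) {x : v.Group} (hx : ∀ i < k, x i = 0) (hxk : x k ≠ 0) :
    (v.M N : ℝ) * v.M k / (32 * B) ≤ ∑ j ∈ Finset.range (v.M N), √‖v.fejerSum j x‖ := by
  obtain ⟨Q, hQ⟩ := v.M_dvd (Nat.succ_le_of_lt hkN)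
  rw [mul_comm] at hQ
  have h1 := Finset.mul_le_sum_range_mul (u := fun j => √‖v.fejerSum j x‖)
    (le_sum_sqrt_norm_fejerSum_block hk hx hxk) Q
  rw [← hQ] at h1
  refine le_trans ?_ h1
  have hB0 : (0 : ℝ) < B := by exact_mod_cast (by have := v.two_le 0; have := hB 0; omega : 0 < B)
  have h2 : (v.M (k + 1) : ℝ) ≤ B * v.M k := by
    rw [M_succ]; exact_mod_cast Nat.mul_le_mul_right _ (hB k)
  rw [hQ, div_le_iff₀ (by positivity)]
  push_cast
  calc (Q * v.M (k + 1) : ℝ) * v.M k ≤ Q * (B * v.M k) * v.M k := by gcongr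
    _ = _ := by ring

theorem haar_real_interval_diff_ge (k : ℕ) :
    (2 * v.M k : ℝ)⁻¹ ≤ v.haar.real (v.interval k 0 \ v.interval (k + 1) 0) := by
  have hsub : v.interval (k + 1) (0 : v.Group) ⊆ v.interval k 0 := fun y hy i hi => hy i (by omega)
  have h0 : (0 : ℝ) < v.M k := by exact_mod_cast v.M_pos k
  have h1 : (2 * v.M k : ℝ) ≤ v.M (k + 1) := by exact_mod_cast v.two_mul_M_le k
  rw [measureReal_sdiff hsub (measurableSet_interval _ _), haar_real_interval, haar_real_interval]
  have h2 : (v.M (k + 1) : ℝ)⁻¹ ≤ (2 * v.M k : ℝ)⁻¹ := inv_anti₀ (by positivity) h1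
  have h3 : (v.M k : ℝ)⁻¹ = 2 * (2 * v.M k : ℝ)⁻¹ := by field_simp
  linarith

/-- On I_k \ I_{k+1} the sum is at least of order M_N M_k, and this layer has measure at least
1/(2M_k). The factors M_k cancel, so the N - 2 layers contribute equally: this is the source of the
logarithm. -/
theorem le_sum_integral_sqrt_fejerSum {B : ℕ} (hB : ∀ k, v.m k ≤ B) (N : ℕ) :
    ((N : ℝ) - 2) * v.M N / (64 * B) ≤
      ∑ j ∈ Finset.range (v.M N), ∫ x, √‖v.fejerSum j x‖ ∂v.haar := by
  have hB0 : (0 : ℝ) < B := by exact_mod_cast (by have := v.two_le 0; have := hB 0; omega : 0 < B)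
  have hl : ∀ j ∈ Finset.range (v.M N), LevelFun N fun x => √‖v.fejerSum j x‖ := fun j hj =>
    (levelFun_fejerSum (Finset.mem_range.1 hj).le).comp fun a => √‖a‖
  let E : ℕ → Set v.Group := fun k => v.interval k 0 \ v.interval (k + 1) 0
  have hEl : ∀ k ∈ Finset.Ico 2 N, ∀ c : ℝ, LevelFun N ((E k).indicator fun _ => c) := by
    intro k hk c
    rw [Finset.mem_Ico] at hk
    refine LevelFun.indicator ?_ (levelFun_const _ _)
    exact ((levelFun_mem_interval k 0).mono hk.2.le).comp₂
      ((levelFun_mem_interval (k + 1) 0).mono hk.2) fun p q => p ∧ ¬ q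
  have hpt : ∀ x, ∑ k ∈ Finset.Ico 2 N,
      (E k).indicator (fun _ => (v.M N : ℝ) * v.M k / (32 * B)) x ≤
        ∑ j ∈ Finset.range (v.M N), √‖v.fejerSum j x‖ := by
    intro x
    by_cases hx : ∃ k ∈ Finset.Ico 2 N, x ∈ E k
    · obtain ⟨k, hk, hxk⟩ := hx
      have hxk' : x k ≠ 0 := fun h => hxk.2 fun i hi => by
        rcases (Nat.lt_succ_iff.1 hi).lt_or_eq with h' | rfl
        · exact hxk.1 i h'
        · exact h
      rw [Finset.sum_eq_single_of_mem k hk, Set.indicator_of_mem hxk]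
      · rw [Finset.mem_Ico] at hk
        exact le_sum_sqrt_norm_fejerSum hB hk.1 hk.2 hxk.1 hxk'
      · refine fun l _ hlk => Set.indicator_of_notMem (fun hxl => ?_) _
        rcases lt_or_gt_of_ne hlk with h | h
        · exact hxl.2 fun i hi => hxk.1 i (by omega)
        · exact hxk' (hxl.1 k h)
    · push Not at hx
      rw [Finset.sum_eq_zero fun k hk => Set.indicator_of_notMem (hx k hk) _]
      exact Finset.sum_nonneg fun _ _ => Real.sqrt_nonneg _
  have hE : ∀ k ∈ Finset.Ico 2 N, (v.M N : ℝ) / (64 * B) ≤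
      ∫ x, (E k).indicator (fun _ => (v.M N : ℝ) * v.M k / (32 * B)) x ∂v.haar := by
    intro k _
    have h0 : (0 : ℝ) < v.M k := by exact_mod_cast v.M_pos k
    have h1 : MeasurableSet (E k) := (measurableSet_interval k 0).diff (measurableSet_interval _ 0)
    rw [integral_indicator_const _ h1, smul_eq_mul]
    calc _ = (2 * v.M k : ℝ)⁻¹ * ((v.M N : ℝ) * v.M k / (32 * B)) := by field_simp; ring
      _ ≤ _ := mul_le_mul_of_nonneg_right (haar_real_interval_diff_ge k) (by positivity)
  rw [← integral_finsetSum _ fun j hj => (hl j hj).integrable]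
  calc _ ≤ ∑ k ∈ Finset.Ico 2 N, (v.M N : ℝ) / (64 * B) := by
        rw [Finset.sum_const, Nat.card_Ico, nsmul_eq_mul, mul_div_assoc]
        have h1 : (N : ℝ) - 2 ≤ ((N - 2 : ℕ) : ℝ) := by
          have : (N : ℝ) ≤ ((N - 2 + 2 : ℕ) : ℝ) := by exact_mod_cast (by omega)
          push_cast at this
          linarith
        gcongr
    _ ≤ ∑ k ∈ Finset.Ico 2 N,
        ∫ x, (E k).indicator (fun _ => (v.M N : ℝ) * v.M k / (32 * B)) x ∂v.haar :=
        Finset.sum_le_sum hE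
    _ = ∫ x, ∑ k ∈ Finset.Ico 2 N,
        (E k).indicator (fun _ => (v.M N : ℝ) * v.M k / (32 * B)) x ∂v.haar := by
        rw [integral_finsetSum _ fun k hk => (hEl k hk _).integrable]
    _ ≤ _ := integral_mono (LevelFun.sum fun k hk => hEl k hk _).integrable
        (LevelFun.sum hl).integrable hpt

end VilenkinSeq

/-! ### Martingales with block-constant coefficients. -/

namespace VilenkinSeq

variable (v : VilenkinSeq)

/-- Coefficients equal to `a_r` on the block `M_r ≤ l < M_{r+1}`. -/
noncomputable def blockCoeff (a : ℕ → ℝ) (l : ℕ) : ℝ :=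
  ∑ r ∈ Finset.range (l + 1), if v.M r ≤ l ∧ l < v.M (r + 1) then a r else 0

/-- The martingale with Vilenkin–Fourier coefficients `c_l`. -/
noncomputable def ofCoeff (c : ℕ → ℝ) (n : ℕ) (x : v.Group) : ℂ :=
  ∑ l ∈ Finset.range (v.M n), (c l : ℂ) * v.psi l x

theorem blockCoeff_eq (a : ℕ → ℝ) {r l : ℕ} (h1 : v.M r ≤ l) (h2 : l < v.M (r + 1)) :
    v.blockCoeff a l = a r := by
  have hr := v.lt_M r
  rw [blockCoeff, Finset.sum_eq_single_of_mem r (Finset.mem_range.2 (by omega)),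
    if_pos ⟨h1, h2⟩]
  intro s _ hs
  refine if_neg fun h => ?_
  rcases lt_or_gt_of_ne hs with hlt | hlt
  · have := v.M_mono (show s + 1 ≤ r from hlt); omega
  · have := v.M_mono (show r + 1 ≤ s from hlt); omega

theorem blockCoeff_zero (a : ℕ → ℝ) : v.blockCoeff a 0 = 0 := by
  simp [blockCoeff]

theorem exists_block {l : ℕ} (hl : l ≠ 0) : ∃ r, v.M r ≤ l ∧ l < v.M (r + 1) := by
  have hex : ∃ r, l < v.M (r + 1) := ⟨l, (v.lt_M l).trans_le (v.M_mono (by omega))⟩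
  classical
  refine ⟨Nat.find hex, ?_, Nat.find_spec hex⟩
  rcases h : Nat.find hex with _ | r
  · simp; omega
  · exact not_lt.1 (Nat.find_min hex (m := r) (by omega))

theorem levelFun_ofCoeff (c : ℕ → ℝ) (n : ℕ) : LevelFun n (v.ofCoeff c n) :=
  LevelFun.sum fun l hl => (levelFun_psi (Finset.mem_range.1 hl)).comp ((c l : ℂ) * ·)

theorem ofCoeff_succ (c : ℕ → ℝ) (n : ℕ) (x : v.Group) : v.ofCoeff c (n + 1) x =
    v.ofCoeff c n x + ∑ l ∈ Finset.Ico (v.M n) (v.M (n + 1)), (c l : ℂ) * v.psi l x := by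
  rw [ofCoeff, ofCoeff, Finset.sum_range_add_sum_Ico _ (v.M_mono (by omega))]

theorem martingale_ofCoeff (c : ℕ → ℝ) : Martingale (v.ofCoeff c) v.filtration v.haar := by
  refine martingale_of_setIntegral_eq_succ (fun n => (v.levelFun_ofCoeff c n).stronglyMeasurable)
    (fun n => (v.levelFun_ofCoeff c n).integrable) fun n s hs => ?_
  have hsl := levelFun_mem_of_measurableSet hs
  have hl : ∀ l ∈ Finset.Ico (v.M n) (v.M (n + 1)),
      LevelFun (n + 1) fun x => (c l : ℂ) * v.psi l x := fun l hl =>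
    (levelFun_psi (Finset.mem_Ico.1 hl).2).comp ((c l : ℂ) * ·)
  have hms : MeasurableSet s := v.filtration.le n _ hs
  simp only [ofCoeff_succ]
  rw [integral_add (v.levelFun_ofCoeff c n).integrable.integrableOn
    (LevelFun.sum hl).integrable.integrableOn, left_eq_add,
    integral_finsetSum _ fun l h => (hl l h).integrable.integrableOn]
  refine Finset.sum_eq_zero fun l h => ?_
  have h1 := LevelFun.integral_mul_psi (Finset.mem_Ico.1 h).1
    (hsl.indicator (levelFun_const n (1 : ℂ)))
  rw [integral_const_mul, ← integral_indicator hms]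
  have h2 : s.indicator (fun x => v.psi l x) =
      fun x => s.indicator (fun _ => (1 : ℂ)) x * v.psi l x := by
    ext x
    by_cases hx : x ∈ s
    · simp [Set.indicator_of_mem hx]
    · simp [Set.indicator_of_notMem hx]
  rw [h2, h1, mul_zero]

theorem coeff_ofCoeff (c : ℕ → ℝ) (k : ℕ) : v.coeff (v.ofCoeff c) k = c k := by
  have hk := v.lt_M k
  rw [coeff_eq (v.martingale_ofCoeff c) hk]
  simp only [ofCoeff, Finset.sum_mul, mul_assoc]
  rw [integral_finsetSum]
  · simp only [integral_const_mul, integral_psi_mul_conj]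
    simp [hk]
  · intro l hl
    exact ((levelFun_psi (Finset.mem_range.1 hl)).mul_conj_psi le_rfl hk).integrable.const_mul _

theorem ofCoeff_blockCoeff (a : ℕ → ℝ) (n : ℕ) (x : v.Group) :
    v.ofCoeff (v.blockCoeff a) n x = ∑ r ∈ Finset.range n,
      (a r : ℂ) * (v.dirichlet (v.M (r + 1)) x - v.dirichlet (v.M r) x) := by
  induction n with
  | zero => simp [ofCoeff, blockCoeff_zero]
  | succ n ih =>
    rw [ofCoeff_succ, ih, Finset.sum_range_succ, dirichlet, dirichlet,
      ← Finset.sum_Ico_eq_sub _ (v.M_mono (by omega : n ≤ n + 1)), Finset.mul_sum]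
    congr 1
    refine Finset.sum_congr rfl fun l hl => ?_
    rw [Finset.mem_Ico] at hl
    rw [v.blockCoeff_eq a hl.1 hl.2]

/-- The block kernel vanishes off I_r and is at most B M_r on it. With the coefficient b² M_r the
right side has integral b√B, so summability of b is what membership in H_{1/2} requires. -/
theorem sqrt_norm_block_le {B : ℕ} (hB : ∀ k, v.m k ≤ B) {b : ℝ} (hb : 0 ≤ b) (r : ℕ)
    (x : v.Group) :
    √‖((b ^ 2 * v.M r : ℝ) : ℂ) * (v.dirichlet (v.M (r + 1)) x - v.dirichlet (v.M r) x)‖ ≤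
      (v.interval r 0).indicator (fun _ => b * √B * v.M r) x := by
  by_cases hx : x ∈ v.interval r 0
  · rw [Set.indicator_of_mem hx]
    have h1 : ‖v.dirichlet (v.M (r + 1)) x - v.dirichlet (v.M r) x‖ ≤ B * v.M r := by
      rw [dirichlet, dirichlet, ← Finset.sum_Ico_eq_sub _ (v.M_mono (by omega : r ≤ r + 1))]
      refine (norm_sum_le _ _).trans ?_
      simp only [norm_psi, Finset.sum_const, Nat.card_Ico, nsmul_eq_mul, mul_one]
      have : v.M (r + 1) ≤ B * v.M r := by
        rw [M_succ]; exact Nat.mul_le_mul_right _ (hB r)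
      exact_mod_cast (Nat.sub_le _ _).trans this
    refine Real.sqrt_le_iff.2 ⟨by positivity, ?_⟩
    rw [norm_mul, Complex.norm_real, Real.norm_of_nonneg (by positivity), mul_pow, mul_pow,
      Real.sq_sqrt (Nat.cast_nonneg B)]
    calc _ ≤ b ^ 2 * v.M r * (B * v.M r) := by gcongr
      _ = _ := by ring
  · rw [Set.indicator_of_notMem hx]
    obtain ⟨i, hi, hxi⟩ : ∃ i < r, x i ≠ 0 := by
      by_contra! h
      exact hx fun i hi => h i hi
    rw [v.dirichlet_M_eq_zero ⟨i, hi, hxi⟩, v.dirichlet_M_eq_zero ⟨i, by omega, hxi⟩]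
    simp

theorem memHardy_ofCoeff {B : ℕ} (hB : ∀ k, v.m k ≤ B) {b : ℕ → ℝ} (hb : ∀ r, 0 ≤ b r)
    (hs : Summable b) :
    v.MemHardy (v.ofCoeff (v.blockCoeff fun r => b r ^ 2 * v.M r)) (1 / 2) := by
  refine ⟨v.martingale_ofCoeff _, ?_⟩
  set f := v.ofCoeff (v.blockCoeff fun r => b r ^ 2 * v.M r)
  suffices h : v.hardyNorm f (1 / 2) ^ (1 / 2 : ℝ) < ∞ by
    contrapose! h
    rw [top_le_iff] at h
    rw [h, ENNReal.top_rpow_of_pos (by norm_num)]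
  let G : ℕ → v.Group → ℝ := fun r => (v.interval r 0).indicator fun _ => b r * √B * v.M r
  have hG : ∀ r, LevelFun r (G r) := fun r =>
    (levelFun_mem_interval r 0).indicator (levelFun_const r _)
  have hG0 : ∀ r x, 0 ≤ G r x := fun r x => Set.indicator_nonneg
    (fun _ _ => mul_nonneg (mul_nonneg (hb r) (Real.sqrt_nonneg _)) (Nat.cast_nonneg _)) x
  have hpt : ∀ x, ‖v.maximal f x‖ₑ ^ (1 / 2 : ℝ) ≤ ∑' r, ENNReal.ofReal (G r x) := by
    intro x
    rw [enorm_eq_self, maximal, one_div, ENNReal.rpow_inv_le_iff (by norm_num)]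
    refine iSup_le fun n => ?_
    rw [← ENNReal.rpow_inv_le_iff (by norm_num), ← one_div, Complex.enorm_rpow_half]
    have h1 : √‖f n x‖ ≤ ∑ r ∈ Finset.range n, G r x := by
      rw [show f n x = _ from v.ofCoeff_blockCoeff _ n x]
      exact (Real.sqrt_norm_sum_le _ _).trans
        (Finset.sum_le_sum fun r _ => v.sqrt_norm_block_le hB (hb r) r x)
    refine (ENNReal.ofReal_le_ofReal h1).trans ?_
    rw [ENNReal.ofReal_sum_of_nonneg fun r _ => hG0 r x]
    exact ENNReal.sum_le_tsum _
  rw [hardyNorm, eLpNorm_half_rpow_half]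
  refine (lintegral_mono hpt).trans_lt ?_
  rw [lintegral_tsum fun r =>
    (((hG r).measurable.mono (v.filtration.le r) le_rfl).ennreal_ofReal).aemeasurable]
  have h2 : ∀ r, ∫⁻ x, ENNReal.ofReal (G r x) ∂v.haar = ENNReal.ofReal (b r * √B) := by
    intro r
    have hM : (v.M r : ℝ) ≠ 0 := by have := v.M_pos r; positivity
    rw [← ofReal_integral_eq_lintegral_ofReal (hG r).integrable (ae_of_all _ (hG0 r)),
      integral_indicator_const _ (measurableSet_interval r 0), haar_real_interval, smul_eq_mul]
    congr 1
    field_simp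
  simp only [h2]
  rw [← ENNReal.ofReal_tsum_of_nonneg (fun r => mul_nonneg (hb r) (Real.sqrt_nonneg _))
    (hs.mul_right _)]
  exact ENNReal.ofReal_lt_top

theorem norm_partialSum_ofCoeff_le {c : ℕ → ℝ} {C : ℝ} {M i : ℕ}
    (hC : ∑ l ∈ Finset.range M, |c l| ≤ C) (hi : i ≤ M) (x : v.Group) :
    ‖v.partialSum i (v.ofCoeff c) x‖ ≤ C := by
  refine ((norm_sum_le _ _).trans ?_).trans hC
  simp only [coeff_ofCoeff, norm_mul, norm_psi, mul_one, Complex.norm_real, Real.norm_eq_abs]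
  exact Finset.sum_le_sum_of_subset_of_nonneg (Finset.range_subset_range.2 hi)
    fun _ _ _ => abs_nonneg _

/-- For i < j one has S_{M_N+i} = S_{M_N} + a ψ_{M_N} D_i. Summation isolates the kernel sum inside
σ_{M_N+j}, and the other partial sums are bounded by the ℓ¹ norm of the coefficients below M_N. -/
theorem mul_norm_fejerSum_le {c : ℕ → ℝ} {a C : ℝ} (ha : 0 ≤ a) {N j : ℕ} (hj : j ≤ v.M N)
    (hc : ∀ l, v.M N ≤ l → l < v.M (N + 1) → c l = a)
    (hC : ∑ l ∈ Finset.range (v.M N), |c l| ≤ C) (x : v.Group) :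
    a * ‖v.fejerSum j x‖ ≤ 2 * v.M N * (‖v.fejer (v.M N + j) (v.ofCoeff c) x‖ + C) := by
  have hM := v.M_pos N
  have h2M := v.two_mul_M_le N
  have hC0 : 0 ≤ C := (Finset.sum_nonneg fun _ _ => abs_nonneg _).trans hC
  have h1 : ∀ i ∈ Finset.range j, v.partialSum (v.M N + i) (v.ofCoeff c) x =
      v.partialSum (v.M N) (v.ofCoeff c) x + a * v.psi (v.M N) x * v.dirichlet i x := by
    intro i hi
    rw [Finset.mem_range] at hi
    rw [partialSum, Finset.sum_range_add, ← partialSum, dirichlet, Finset.mul_sum]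
    congr 1
    refine Finset.sum_congr rfl fun l hl => ?_
    rw [Finset.mem_range] at hl
    have h2 := v.psi_block 1 (s := l) (k := N) (by omega) x
    rw [one_mul] at h2
    rw [coeff_ofCoeff, hc _ (by omega) (by omega), h2]
    ring
  have h2 : (a : ℂ) * v.psi (v.M N) x * v.fejerSum j x =
      ∑ i ∈ Finset.range (v.M N + j), v.partialSum i (v.ofCoeff c) x -
      (∑ i ∈ Finset.range (v.M N), v.partialSum i (v.ofCoeff c) x +
        ∑ _i ∈ Finset.range j, v.partialSum (v.M N) (v.ofCoeff c) x) := by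
    rw [Finset.sum_range_add, Finset.sum_congr rfl h1, Finset.sum_add_distrib, fejerSum,
      Finset.mul_sum]
    ring
  have h3 : ∑ i ∈ Finset.range (v.M N + j), v.partialSum i (v.ofCoeff c) x =
      ((v.M N + j : ℕ) : ℂ) * v.fejer (v.M N + j) (v.ofCoeff c) x := by
    have : ((v.M N + j : ℕ) : ℂ) ≠ 0 := by exact_mod_cast (by omega : v.M N + j ≠ 0)
    rw [fejer, ← mul_assoc, mul_inv_cancel₀ this, one_mul]
  have h4 : ‖∑ i ∈ Finset.range (v.M N), v.partialSum i (v.ofCoeff c) x‖ ≤ v.M N * C := by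
    refine (norm_sum_le_of_le _ fun i hi =>
      v.norm_partialSum_ofCoeff_le hC (Finset.mem_range.1 hi).le x).trans_eq ?_
    rw [Finset.sum_const, Finset.card_range, nsmul_eq_mul]
  have h5 : ‖∑ _i ∈ Finset.range j, v.partialSum (v.M N) (v.ofCoeff c) x‖ ≤ v.M N * C := by
    refine (norm_sum_le_of_le _ fun i _ =>
      v.norm_partialSum_ofCoeff_le hC le_rfl x).trans ?_
    rw [Finset.sum_const, Finset.card_range, nsmul_eq_mul]
    gcongr
  have h6 := congrArg norm h2
  rw [norm_mul, norm_mul, norm_psi, mul_one, Complex.norm_real, Real.norm_of_nonneg ha, h3] at h6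
  rw [h6]
  have h7 : ((v.M N + j : ℕ) : ℝ) ≤ 2 * v.M N := by exact_mod_cast (by omega)
  calc _ ≤ ((v.M N + j : ℕ) : ℝ) * ‖v.fejer (v.M N + j) (v.ofCoeff c) x‖ +
        (v.M N * C + v.M N * C) := by
        refine (norm_sub_le _ _).trans (add_le_add ?_ ((norm_add_le _ _).trans (add_le_add h4 h5)))
        rw [norm_mul, Complex.norm_natCast]
    _ ≤ 2 * v.M N * ‖v.fejer (v.M N + j) (v.ofCoeff c) x‖ + (v.M N * C + v.M N * C) := by gcongr
    _ = _ := by ring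

/-- Only the indices M_N + j with j < M_N are used; the other terms are nonnegative. The ℓ¹ bound is
written C² because it enters under a square root. -/
theorem le_sum_integral_sqrt_fejer {B : ℕ} (hB : ∀ k, v.m k ≤ B) {c : ℕ → ℝ} {b C : ℝ}
    (hb : 0 ≤ b) {N : ℕ} (hc : ∀ l, v.M N ≤ l → l < v.M (N + 1) → c l = b ^ 2 * v.M N)
    (hC : ∑ l ∈ Finset.range (v.M N), |c l| ≤ C ^ 2) (hC0 : 0 ≤ C) :
    b * ((N : ℝ) - 2) * v.M N / (128 * B) - v.M N * C ≤
      ∑ k ∈ Finset.Icc 1 (2 * v.M N), ∫ x, √‖v.fejer k (v.ofCoeff c) x‖ ∂v.haar := by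
  have hM : (0 : ℝ) < v.M N := by exact_mod_cast v.M_pos N
  have hB0 : (0 : ℝ) < B := by exact_mod_cast (by have := v.two_le 0; have := hB 0; omega : 0 < B)
  set q : ℕ → ℝ := fun k => ∫ x, √‖v.fejer k (v.ofCoeff c) x‖ ∂v.haar
  have hq0 : ∀ k, 0 ≤ q k := fun k => integral_nonneg fun x => Real.sqrt_nonneg _
  have h1 : ∀ j ∈ Finset.range (v.M N),
      b * ∫ x, √‖v.fejerSum j x‖ ∂v.haar ≤ 2 * (q (v.M N + j) + C) := by
    intro j hj
    rw [Finset.mem_range] at hj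
    have hσ := (levelFun_fejer (v.lt_M (v.M N + j)).le (v.ofCoeff c)).comp fun a => √‖a‖
    have hF := (levelFun_fejerSum (v := v) hj.le).comp fun a => √‖a‖
    have h2 : ∀ x, b * √‖v.fejerSum j x‖ ≤
        2 * (√‖v.fejer (v.M N + j) (v.ofCoeff c) x‖ + C) := by
      intro x
      have h3 := v.mul_norm_fejerSum_le (a := b ^ 2 * v.M N) (by positivity) hj.le hc hC x
      have h4 : b ^ 2 * ‖v.fejerSum j x‖ ≤
          2 ^ 2 * (‖v.fejer (v.M N + j) (v.ofCoeff c) x‖ + C ^ 2) := by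
        have h5 : 0 ≤ ‖v.fejer (v.M N + j) (v.ofCoeff c) x‖ + C ^ 2 := by positivity
        refine le_of_mul_le_mul_left ?_ hM
        nlinarith
      have h6 := Real.sqrt_le_sqrt h4
      rw [Real.sqrt_mul (by positivity), Real.sqrt_sq hb, Real.sqrt_mul (by positivity),
        Real.sqrt_sq (by norm_num)] at h6
      refine h6.trans (mul_le_mul_of_nonneg_left ?_ (by norm_num))
      refine (Real.sqrt_add_le_sqrt_add_sqrt (norm_nonneg _) (sq_nonneg C)).trans ?_
      rw [Real.sqrt_sq hC0]
    rw [← integral_const_mul]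
    calc _ ≤ ∫ x, 2 * (√‖v.fejer (v.M N + j) (v.ofCoeff c) x‖ + C) ∂v.haar :=
          integral_mono (hF.integrable.const_mul b)
            ((hσ.integrable.add (integrable_const C)).const_mul 2) h2
      _ = _ := by
          rw [integral_const_mul, integral_add hσ.integrable (integrable_const C)]
          simp [q]
  have h2 := Finset.sum_le_sum h1
  rw [← Finset.mul_sum, ← Finset.mul_sum, Finset.sum_add_distrib, Finset.sum_const,
    Finset.card_range, nsmul_eq_mul] at h2
  have h3 := mul_le_mul_of_nonneg_left (le_sum_integral_sqrt_fejerSum hB N) hb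
  have h4 : ∑ j ∈ Finset.range (v.M N), q (v.M N + j) ≤ ∑ k ∈ Finset.Icc 1 (2 * v.M N), q k := by
    rw [← Finset.sum_image (s := Finset.range (v.M N)) (g := fun j => v.M N + j) (f := q)
      fun _ _ _ _ h => Nat.add_left_cancel h]
    refine Finset.sum_le_sum_of_subset_of_nonneg (fun k hk => ?_) fun k _ _ => hq0 k
    obtain ⟨j, hj, rfl⟩ := Finset.mem_image.1 hk
    have := v.M_pos N
    rw [Finset.mem_range] at hj
    rw [Finset.mem_Icc]
    omega
  have h5 : b * ((N : ℝ) - 2) * v.M N / (128 * B) =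
      (b * (((N : ℝ) - 2) * v.M N / (64 * B))) / 2 := by field_simp; ring
  rw [h5]
  linarith

/-! ### Choice of the lacunary indices and divergence. -/

theorem M_le_pow {B : ℕ} (hB : ∀ k, v.m k ≤ B) (k : ℕ) : v.M k ≤ B ^ k := by
  induction k with
  | zero => simp
  | succ k ih => rw [M_succ, pow_succ, mul_comm]; exact Nat.mul_le_mul ih (hB k)

/-- Take n with log n / φ n large and N with 2M_N ≤ n < 2M_{N+1}. Then log n ≤ (N+2) log B, and φ
(2M_N) ≤ φ n by monotonicity. -/
theorem exists_index_large {B : ℕ} (hB : ∀ k, v.m k ≤ B) {φ : ℕ → ℝ}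
    (hφ1 : ∀ n, 1 ≤ n → 1 ≤ φ n) (hφ : MonotoneOn φ (Set.Ici 1))
    (hlim : limsup (fun n : ℕ => ((Real.log n / φ n : ℝ) : EReal)) atTop = ⊤) (T : ℝ) (a : ℕ) :
    ∃ N, a < N ∧ T ≤ ((N : ℝ) - 2) / φ (2 * v.M N) := by
  have hB2 : 2 ≤ B := (v.two_le 0).trans (hB 0)
  have hlogB : 0 < Real.log B := Real.log_pos (by exact_mod_cast hB2)
  -- The surplus 4 pays for passing from N + 2 to N - 2, as φ ≥ 1.
  have hfreq : ∃ᶠ n : ℕ in atTop,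
      (((T + 4) * Real.log B : ℝ) : EReal) < ((Real.log n / φ n : ℝ) : EReal) :=
    frequently_lt_of_lt_limsup (by isBoundedDefault) (by rw [hlim]; exact EReal.coe_lt_top _)
  obtain ⟨n, hn, hna⟩ := (hfreq.and_eventually (eventually_ge_atTop (2 * v.M (a + 1)))).exists
  rw [EReal.coe_lt_coe_iff] at hn
  classical
  have hex : ∃ N, n < 2 * v.M (N + 1) :=
    ⟨n, by have := v.lt_M (n + 1); omega⟩
  set N := Nat.find hex with hN
  have hN1 : n < 2 * v.M (N + 1) := Nat.find_spec hex
  have haN : a < N := by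
    by_contra h
    have := v.M_mono (show N + 1 ≤ a + 1 by omega)
    omega
  have hN2 : 2 * v.M N ≤ n := by
    have h := Nat.find_min hex (m := N - 1) (by omega)
    rw [Nat.sub_add_cancel (by omega)] at h
    exact not_lt.1 h
  have hMpos := v.M_pos N
  refine ⟨N, haN, ?_⟩
  have h1 : φ (2 * v.M N) ≤ φ n := hφ (Set.mem_Ici.2 (by omega)) (Set.mem_Ici.2 (by omega)) hN2
  have h2 : 1 ≤ φ (2 * v.M N) := hφ1 _ (by omega)
  have h3 : Real.log n ≤ (N + 2) * Real.log B := by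
    have h4 : n ≤ B ^ (N + 2) := by
      calc n ≤ 2 * v.M (N + 1) := hN1.le
        _ ≤ B * B ^ (N + 1) := Nat.mul_le_mul hB2 (v.M_le_pow hB _)
        _ = _ := by ring
    have h5 := Real.log_le_log (by exact_mod_cast (by omega : 0 < n))
      (show (n : ℝ) ≤ (B : ℝ) ^ (N + 2) by exact_mod_cast h4)
    rwa [Real.log_pow, Nat.cast_add, Nat.cast_ofNat] at h5
  have h4 : (T + 4) * Real.log B < (N + 2) / φ (2 * v.M N) * Real.log B := by
    calc _ < Real.log n / φ n := hn
      _ ≤ (N + 2) * Real.log B / φ (2 * v.M N) := by gcongr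
      _ = _ := by ring
  have h5 := lt_of_mul_lt_mul_right h4 hlogB.le
  have h6 : 4 / φ (2 * v.M N) ≤ 4 := div_le_self (by norm_num) h2
  have h7 : ((N : ℝ) - 2) / φ (2 * v.M N) =
      (N + 2) / φ (2 * v.M N) - 4 / φ (2 * v.M N) := by ring
  linarith

/-- σ_k f depends on k coordinates only, so it is itself the k-th term of the martingale it
generates. -/
theorem eLpNorm_fejer_le_hardyNorm (k : ℕ) (f : ℕ → v.Group → ℂ) :
    eLpNorm (v.fejer k f) (1 / 2) v.haar ≤
      v.hardyNorm (v.regularMartingale (v.fejer k f)) (1 / 2) := by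
  have hl := levelFun_fejer (v.lt_M k).le f
  refine eLpNorm_mono_enorm fun x => ?_
  have h1 : v.regularMartingale (v.fejer k f) k = v.fejer k f :=
    condExp_of_stronglyMeasurable (v.filtration.le k) hl.stronglyMeasurable hl.integrable
  rw [enorm_eq_self, maximal]
  exact le_iSup_of_le k (by rw [h1])

theorem exists_divergent {B : ℕ} (hB : ∀ k, v.m k ≤ B) {φ : ℕ → ℝ}
    (hφ1 : ∀ n, 1 ≤ n → 1 ≤ φ n) (hφ : MonotoneOn φ (Set.Ici 1))
    (hlim : limsup (fun n : ℕ => ((Real.log n / φ n : ℝ) : EReal)) atTop = ⊤) :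
    ∃ f : ℕ → v.Group → ℂ, v.MemHardy f (1 / 2) ∧
      ∀ i : ℕ, ∃ n, 1 ≤ n ∧
        (i : ℝ) * (n * φ n) ≤ ∑ k ∈ Finset.Icc 1 n, ∫ x, √‖v.fejer k f x‖ ∂v.haar := by
  have hB0 : (0 : ℝ) < B := by exact_mod_cast (by have := v.two_le 0; have := hB 0; omega : 0 < B)
  choose pick hpick1 hpick2 using v.exists_index_large hB hφ1 hφ hlim
  -- N_{i+1} is chosen after N_i. The factor 256 B 2^{i+1} cancels 2^{-(i+1)} / (128 B) in
  -- `le_sum_integral_sqrt_fejer` up to a factor 2; the summand i gives the divergence, and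
  -- M_{N_i+1} absorbs the error of the earlier blocks.
  obtain ⟨N, hNlt, hNbig⟩ : ∃ N : ℕ → ℕ, (∀ i, N i < N (i + 1)) ∧
      ∀ i : ℕ, 256 * B * 2 ^ (i + 1) * (i + v.M (N i + 1)) ≤
        ((N (i + 1) : ℝ) - 2) / φ (2 * v.M (N (i + 1))) :=
    ⟨fun i => Nat.rec 0 (fun i a => pick (256 * B * 2 ^ (i + 1) * (i + v.M (a + 1))) a) i,
      fun i => hpick1 _ _, fun i => hpick2 _ _⟩
  have hNmono : StrictMono N := strictMono_nat_of_lt_succ hNlt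
  let b : ℕ → ℝ := Function.extend N (fun i => (1 / 2) ^ i) 0
  have hbN : ∀ i, b (N i) = (1 / 2) ^ i := fun i => hNmono.injective.extend_apply _ _ i
  have hb' : ∀ r, b r = 0 ∨ ∃ i, N i = r := fun r => by
    by_cases h : ∃ i, N i = r
    · exact Or.inr h
    · exact Or.inl (Function.extend_apply' _ _ _ h)
  have hb0 : ∀ r, 0 ≤ b r := fun r => by
    rcases hb' r with h | ⟨i, rfl⟩
    · rw [h]
    · rw [hbN]; positivity
  have hbs : Summable b :=
    (hasSum_extend_zero hNmono.injective).2 summable_geometric_two.hasSum |>.summable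
  set c := v.blockCoeff fun r => b r ^ 2 * v.M r
  refine ⟨v.ofCoeff c, v.memHardy_ofCoeff hB hb0 hbs, fun i => ?_⟩
  have hM := v.M_pos (N (i + 1))
  have hM' : (0 : ℝ) < v.M (N (i + 1)) := by exact_mod_cast hM
  refine ⟨2 * v.M (N (i + 1)), by omega, ?_⟩
  -- Up to M_{N_{i+1}} the coefficients vanish from M_{N_i+1} on and never exceed M_{N_i+1}, so
  -- their ℓ¹ norm is at most the square of that number and C = M_{N_i+1} is admissible.
  have hcoef : ∀ l ∈ Finset.range (v.M (N (i + 1))),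
      |c l| ≤ if l < v.M (N i + 1) then (v.M (N i + 1) : ℝ) else 0 := by
    intro l hl
    rw [Finset.mem_range] at hl
    rcases eq_or_ne l 0 with rfl | hl0
    · simp only [c, blockCoeff_zero, abs_zero]
      split_ifs <;> positivity
    · obtain ⟨r, h1, h2⟩ := v.exists_block hl0
      have h3 : c l = b r ^ 2 * v.M r := v.blockCoeff_eq _ h1 h2
      rw [h3]
      rcases hb' r with h | ⟨s, rfl⟩
      · rw [h]
        simp only [ne_eq, OfNat.ofNat_ne_zero, not_false_eq_true, zero_pow, zero_mul, abs_zero]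
        split_ifs <;> positivity
      · have hsi : s ≤ i := by
          by_contra hs
          have := v.M_mono (hNmono.monotone (show i + 1 ≤ s by omega))
          omega
        have hNs := hNmono.monotone hsi
        have h4 := v.M_mono (show N s + 1 ≤ N i + 1 by omega)
        have h5 : (v.M (N s) : ℝ) ≤ v.M (N i + 1) := by
          exact_mod_cast v.M_mono (show N s ≤ N i + 1 by omega)
        rw [if_pos (by omega), abs_of_nonneg (by positivity), hbN]
        refine (mul_le_of_le_one_left (by positivity) ?_).trans h5
        exact pow_le_one₀ (by positivity) (pow_le_one₀ (by norm_num) (by norm_num))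
  have hC : ∑ l ∈ Finset.range (v.M (N (i + 1))), |c l| ≤ (v.M (N i + 1) : ℝ) ^ 2 := by
    refine (Finset.sum_le_sum hcoef).trans ?_
    rw [← Finset.sum_filter, Finset.sum_const, nsmul_eq_mul, sq]
    gcongr
    calc _ ≤ (Finset.range (v.M (N i + 1))).card := Finset.card_le_card fun l hl =>
          Finset.mem_range.2 (Finset.mem_filter.1 hl).2
      _ = _ := Finset.card_range _
  have hmain := v.le_sum_integral_sqrt_fejer hB (c := c) (hb0 (N (i + 1)))
    (fun l h1 h2 => v.blockCoeff_eq _ h1 h2) hC (Nat.cast_nonneg _)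
  refine le_trans ?_ hmain
  have hφ0 : 1 ≤ φ (2 * v.M (N (i + 1))) := hφ1 _ (by omega)
  have hbig := hNbig i
  rw [le_div_iff₀ (by linarith)] at hbig
  rw [hbN]
  set P := φ (2 * v.M (N (i + 1)))
  set M' : ℝ := (v.M (N (i + 1)) : ℝ)
  set K : ℝ := (v.M (N i + 1) : ℝ)
  have hK : 0 ≤ K := Nat.cast_nonneg _
  have h1 : (1 / 2 : ℝ) ^ (i + 1) * (256 * B * 2 ^ (i + 1) * (i + K) * P) * M' / (128 * B) ≤
      (1 / 2 : ℝ) ^ (i + 1) * ((N (i + 1) : ℝ) - 2) * M' / (128 * B) := by gcongr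
  have h2 : (1 / 2 : ℝ) ^ (i + 1) * (256 * B * 2 ^ (i + 1) * (i + K) * P) * M' / (128 * B) =
      2 * (i + K) * P * M' := by
    rw [one_div, inv_pow]
    field_simp
    ring
  have h3 : M' * K ≤ 2 * K * P * M' := by
    have : 0 ≤ M' * K := by positivity
    nlinarith
  push_cast
  calc (i : ℝ) * (2 * M' * P) ≤ 2 * (i + K) * P * M' - M' * K := by linarith
    _ ≤ _ := by linarith

end VilenkinSeq

theorem mainTheorem10 :
    (∀ B : ℕ, ∃ c : ℝ≥0, ∀ v : VilenkinSeq, (∀ k, v.m k ≤ B) →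
      ∀ f : ℕ → v.Group → ℂ, v.MemHardy f (1 / 2) →
        (⨆ n : ℕ, ⨆ _ : 2 ≤ n, (ENNReal.ofReal (n * Real.log n))⁻¹ *
            ∑ k ∈ Finset.Icc 1 n, eLpNorm (v.fejer k f) (1 / 2) v.haar ^ (1 / 2 : ℝ))
          ≤ c * v.hardyNorm f (1 / 2) ^ (1 / 2 : ℝ)) ∧
    (∀ v : VilenkinSeq, (∃ B : ℕ, ∀ k, v.m k ≤ B) →
      ∀ φ : ℕ → ℝ, (∀ n, 1 ≤ n → 1 ≤ φ n) → MonotoneOn φ (Set.Ici 1) →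
        limsup (fun n : ℕ => ((Real.log n / φ n : ℝ) : EReal)) atTop = ⊤ →
        ∃ f : ℕ → v.Group → ℂ, v.MemHardy f (1 / 2) ∧
          (⨆ n : ℕ, ⨆ _ : 1 ≤ n, (ENNReal.ofReal (n * φ n))⁻¹ *
            ∑ k ∈ Finset.Icc 1 n, eLpNorm (v.fejer k f) (1 / 2) v.haar ^ (1 / 2 : ℝ)) = ⊤ ∧
          (⨆ n : ℕ, ⨆ _ : 1 ≤ n, (ENNReal.ofReal (n * φ n))⁻¹ *
            ∑ k ∈ Finset.Icc 1 n,
              v.hardyNorm (v.regularMartingale (v.fejer k f)) (1 / 2) ^ (1 / 2 : ℝ)) = ⊤) := by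
  constructor
  · intro B
    refine ⟨(4 + 18 * B * (2 + 6 * B ^ 2) : ℝ).toNNReal, fun v hB f hf => ?_⟩
    exact iSup₂_le fun n hn => VilenkinSeq.strong_summability hB hf.1 hn
  · rintro v ⟨B, hB⟩ φ hφ1 hφ hlim
    obtain ⟨f, hf, hdiv⟩ := v.exists_divergent hB hφ1 hφ hlim
    have h1 : (⨆ n : ℕ, ⨆ _ : 1 ≤ n, (ENNReal.ofReal (n * φ n))⁻¹ *
        ∑ k ∈ Finset.Icc 1 n, eLpNorm (v.fejer k f) (1 / 2) v.haar ^ (1 / 2 : ℝ)) = ⊤ := by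
      by_contra hne
      obtain ⟨i, hi⟩ := ENNReal.exists_nat_gt hne
      obtain ⟨n, hn, hle⟩ := hdiv i
      have hpos : 0 < n * φ n :=
        mul_pos (by exact_mod_cast hn) (zero_lt_one.trans_le (hφ1 n hn))
      refine absurd (hi.trans_le ?_) (not_lt.2 (le_iSup₂ (f := fun (n : ℕ) (_ : 1 ≤ n) =>
        (ENNReal.ofReal (n * φ n))⁻¹ * ∑ k ∈ Finset.Icc 1 n,
          eLpNorm (v.fejer k f) (1 / 2) v.haar ^ (1 / 2 : ℝ)) n hn))
      simp only [VilenkinSeq.eLpNorm_rpow_half_eq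
        (VilenkinSeq.levelFun_fejer (v.lt_M _).le f)]
      rw [← ENNReal.ofReal_sum_of_nonneg fun k _ => integral_nonneg fun x => Real.sqrt_nonneg _,
        ← ENNReal.ofReal_inv_of_pos hpos, ← ENNReal.ofReal_mul (by positivity),
        ← ENNReal.ofReal_natCast]
      refine ENNReal.ofReal_le_ofReal ?_
      rw [inv_mul_eq_div, le_div_iff₀ hpos]
      exact hle
    refine ⟨f, hf, h1, top_le_iff.1 (h1.symm.trans_le (iSup₂_mono fun n _ => ?_))⟩
    gcongr with k
    exact v.eLpNorm_fejer_le_hardyNorm k f
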